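/- **Setting.** Let $\mathcal A$ be a finite alphabet, $H$ a $\{0,1\}$-matrix indexed by $\mathcal A$, and $\Sigma_H=\{x\in\mathcal A^{\mathbb Z}: H_{x_i,x_{i+1}}=1\ \forall i\}$ the two-sided subshift of finite type with left shift $\sigma$ and metric $\mathrm{dist}(x,y)=2^{-\min\{|i|:x_i\ne y_i\}}$ (and $\mathrm{dist}(x,x)=0$). Assume that $\sigma:\Sigma_H\to\Sigma_H$ is transitive (some forward orbit is dense) and has positive topological entropy. Let $G\subset \mathrm{GL}(d,\mathbb R)$ be a closed subgroup, $\|\cdot\|$ the Euclidean operator norm, and $\alpha>0$. For $A:\Sigma_H\to G$ put $A_n(x)=A(\sigma^{n-1}x)\cdots A(x)$ for $n\ge 0$, $A_{-n}(x)=A_n(\sigma^{-n}x)^{-1}$, and $$\mathrm B(A,\kappa)=\{x\in\Sigma_H:\ \|A_n(x)\|\le\kappa \text{ and } \|A_n(x)^{-1}\|\le\kappa\ \text{ for all } n\in\mathbb Z\}.$$ Put $d_{\mathcal C^\alpha}(A,\tilde A)=\|A-\tilde A\|_{\mathcal C^0}+|A-\tilde A|_{\mathcal C^\alpha}$, where $\|F\|_{\mathcal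 C^0}=\sup_x\|F(x)\|$ and $|F|_{\mathcal C^\alpha}=\sup\{\|F(x)-F(y)\|/\mathrm{dist}(x,y)^\alpha: 0<\mathrm{dist}(x,y)<\mathrm{diam}(\Sigma_H)\}$. For a set $E\subset\Sigma_H$, not necessarily invariant, $h_{\rm top}(\sigma|_E)$ denotes Bowen's entropy: the supremum over $\delta>0$ of the exponential growth rate ($\limsup$) in $n$ of the least number of dynamical $(n,\delta)$-balls that cover $E$. **Multiple covering.** A word is admissible if it is finite, non-empty and all its consecutive letters $a,b$ satisfy $H_{a,b}=1$. For words $\underline a,\underline b$ let $T(\underline a,\underline b)$ be the set of admissible words with prefix $\underline a$ and suffix $\underline b$. A locally constant $A:\Sigma_H\to G$ satisfies the *multiple covering condition of $m$ layers* if, for some $k\ge0$, $A(x)=\phi(x_{-k},\dots,x_k)$ for a $G$-valued function $\phi$ of words of length $2k+1$, and there are finitely many (at least one) non-empty precompact open sets $\mathcal U_1,\dots,\mathcal U_n\subset G$, with union $\mathcal U$, a non-empty set $\mathcal A'$ of admissible words of length $2k+1$, and non-empty sets $\Lambda_i^j(\underline a)\subset\bigcup_{\underline b\in\mathcal A'}T(\underline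 a,\underline b)$ ($\underline a\in\mathcal A'$, $1\le i\le n$, $1\le j\le m$) such that for all $\underline a\in\mathcal A'$ and $i$: the sets $\Lambda_i^1(\underline a),\dots,\Lambda_i^m(\underline a)$ are mutually disjoint, no word of their union is a strict prefix of another one, and for every $j$ $$\overline{\mathcal U_i}\subset\bigcup_{\underline w\in\Lambda_i^j(\underline a)}(A_{[\underline w\rangle})^{-1}\,\mathcal U .$$ Here, for $\underline w=(w_1,\dots,w_N)$, $A_{[\underline w\rangle}=\phi(w_{N-2k-1},\dots,w_{N-1})\cdots\phi(w_2,\dots,w_{2k+2})\,\phi(w_1,\dots,w_{2k+1})$ is the product over all blocks of length $2k+1$ of $\underline w$ except the last one. **Theorem.** Let $A:\Sigma_H\to G$ be locally constant and satisfy the multiple covering condition of $m$ layers for some $m>1$. Then there are $\varepsilon,\kappa,\gamma>0$ such that for every $\alpha$-Hölder $\tilde A:\Sigma_H\to G$ with $d_{\mathcal C^\alpha}(A,\tilde A)<\varepsilon$ the set $\mathrm B(\tilde A,\kappa)$ is non-empty and $$h_{\rm top}\big(\sigma|_{\mathrm B(\tilde A,\kappa)}\big)\ \ge\ \gamma .$$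 Moreover $\mathrm B(\tilde A,\kappa)$ contains a closed set $Y$ with $\sigma(Y)=Y$ and $h_{\rm top}(\sigma|_Y)\ge\gamma$, and one can take $\gamma=(\log m)/L$ with an integer $L\ge1$ such that the multiple covering condition of $m$ layers for $A$ is realized by data (some $k,\phi,\mathcal U_i,\mathcal A',\Lambda_i^j(\underline a)$ as above) in which every word in the sets $\Lambda_i^j(\underline a)$ has length at most $L$. -/

import Mathlib

open scoped Matrix.Norms.L2Operator MatrixGroups ENNReal

/-! ### Subshifts of finite type -/

/-- The two-sided subshift of finite type of a transition matrix `H`: the bi-infinite sequences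
`x` over the alphabet with `H (x i) (x (i + 1)) = 1` for every `i : ℤ`. -/
def SFT {𝒜 : Type*} (H : Matrix 𝒜 𝒜 ℕ) : Type _ :=
  {x : ℤ → 𝒜 // ∀ i : ℤ, H (x i) (x (i + 1)) = 1}

namespace SFT

variable {𝒜 : Type*} {H : Matrix 𝒜 𝒜 ℕ}

instance : CoeFun (SFT H) (fun _ => ℤ → 𝒜) := ⟨Subtype.val⟩

theorem ext' {x y : SFT H} (h : ∀ i : ℤ, x i = y i) : x = y :=
  Subtype.ext (funext h)

/-- The smallest `|i|` with `x i ≠ y i` (only used for `x ≠ y`). -/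
noncomputable def firstDiff (x y : SFT H) : ℕ :=
  sInf {n : ℕ | ∃ i : ℤ, i.natAbs = n ∧ x i ≠ y i}

open Classical in
/-- `dist x y = 2 ^ (-n)` with `n = min {|i| : x i ≠ y i}`, and `dist x x = 0`. -/
noncomputable instance : Dist (SFT H) :=
  ⟨fun x y => if x = y then 0 else (2 : ℝ)⁻¹ ^ firstDiff x y⟩

theorem dist_self' (x : SFT H) : dist x x = 0 := if_pos rfl

theorem dist_of_ne {x y : SFT H} (h : x ≠ y) : dist x y = (2 : ℝ)⁻¹ ^ firstDiff x y := if_neg h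

theorem firstDiff_comm (x y : SFT H) : firstDiff x y = firstDiff y x := by
  simp only [firstDiff, ne_comm]

theorem firstDiff_spec {x y : SFT H} (h : x ≠ y) :
    ∃ i : ℤ, i.natAbs = firstDiff x y ∧ x i ≠ y i := by
  have hne : {n : ℕ | ∃ i : ℤ, i.natAbs = n ∧ x i ≠ y i}.Nonempty := by
    by_contra hcon
    rw [Set.not_nonempty_iff_eq_empty] at hcon
    apply h
    apply ext'
    intro i
    by_contra hi
    have hmem : i.natAbs ∈ {n : ℕ | ∃ i : ℤ, i.natAbs = n ∧ x i ≠ y i} := ⟨i, rfl, hi⟩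
    rw [hcon] at hmem
    exact hmem
  exact Nat.sInf_mem hne

theorem firstDiff_le {x y : SFT H} {i : ℤ} (h : x i ≠ y i) : firstDiff x y ≤ i.natAbs :=
  Nat.sInf_le ⟨i, rfl, h⟩

theorem dist_nonneg' (x y : SFT H) : 0 ≤ dist x y := by
  by_cases h : x = y
  · rw [h, dist_self']
  · rw [dist_of_ne h]; positivity

theorem dist_comm' (x y : SFT H) : dist x y = dist y x := by
  by_cases h : x = y
  · rw [h]
  · rw [dist_of_ne h, dist_of_ne (Ne.symm h), firstDiff_comm]

theorem dist_le_max (x y z : SFT H) : dist x z ≤ max (dist x y) (dist y z) := by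
  by_cases hxz : x = z
  · rw [hxz, dist_self']
    exact le_max_of_le_left (dist_nonneg' _ _)
  · obtain ⟨i, hi, hne⟩ := firstDiff_spec hxz
    rw [dist_of_ne hxz, ← hi]
    by_cases h1 : x i = y i
    · have h2 : y i ≠ z i := fun h => hne (h1.trans h)
      have h3 : y ≠ z := fun h => h2 (by rw [h])
      refine le_max_of_le_right ?_
      rw [dist_of_ne h3]
      exact pow_le_pow_of_le_one (by norm_num) (by norm_num) (firstDiff_le h2)
    · have h3 : x ≠ y := fun h => h1 (by rw [h])
      refine le_max_of_le_left ?_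
      rw [dist_of_ne h3]
      exact pow_le_pow_of_le_one (by norm_num) (by norm_num) (firstDiff_le h1)

/-- The topology and the uniformity of the subshift are those of this metric. -/
noncomputable instance : MetricSpace (SFT H) where
  dist_self := dist_self'
  dist_comm := dist_comm'
  dist_triangle x y z := (dist_le_max x y z).trans
    (max_le_add_of_nonneg (dist_nonneg' x y) (dist_nonneg' y z))
  eq_of_dist_eq_zero := by
    intro x y h
    by_contra hne
    rw [dist_of_ne hne] at h
    have : (0 : ℝ) < (2 : ℝ)⁻¹ ^ firstDiff x y := by positivity
    exact absurd h this.ne'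

/-- The left shift `(σ x) i = x (i + 1)`, as a bijection of the subshift. -/
def shift (H : Matrix 𝒜 𝒜 ℕ) : Equiv.Perm (SFT H) where
  toFun x := ⟨fun i => x (i + 1), fun i => x.2 (i + 1)⟩
  invFun x := ⟨fun i => x (i - 1), fun i => by
    have h := x.2 (i - 1)
    rw [show i - 1 + 1 = i + 1 - 1 by ring] at h
    exact h⟩
  left_inv x := ext' fun i => congrArg x.1 (sub_add_cancel i 1)
  right_inv x := ext' fun i => congrArg x.1 (add_sub_cancel_right i 1)

/-- The block `(x_{-k}, …, x_k)`. -/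
def block (k : ℕ) (x : SFT H) : List 𝒜 :=
  List.ofFn fun i : Fin (2 * k + 1) => x ((i : ℤ) - k)

end SFT

/-- The subshift is topologically transitive: some forward orbit is dense. -/
def IsTransitiveSFT {𝒜 : Type*} (H : Matrix 𝒜 𝒜 ℕ) : Prop :=
  ∃ x : SFT H, Dense (Set.range fun n : ℕ => (SFT.shift H ^ n) x)

/-! ### Admissible words and transitions -/

/-- Non-empty finite words whose consecutive letters are allowed by `H`. -/
def IsAdmissible {𝒜 : Type*} (H : Matrix 𝒜 𝒜 ℕ) (w : List 𝒜) : Prop :=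
  w ≠ [] ∧ w.IsChain (fun a b => H a b = 1)

/-- The admissible words of length `n`. -/
def admissibleWords {𝒜 : Type*} (H : Matrix 𝒜 𝒜 ℕ) (n : ℕ) : Set (List 𝒜) :=
  {w | IsAdmissible H w ∧ w.length = n}

/-- The transitions from `a` to `b`: the admissible words with prefix `a` and suffix `b`. -/
def transitions {𝒜 : Type*} (H : Matrix 𝒜 𝒜 ℕ) (a b : List 𝒜) : Set (List 𝒜) :=
  {w | IsAdmissible H w ∧ a <+: w ∧ b <:+ w}

/-! ### Cocycles -/

section Cocycle

variable {X G : Type*} [Group G]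

/-- `A_n(x) = A(f^{n-1} x) ⋯ A(f x) A(x)` for `n : ℕ`. -/
def cocycleNat (f : Equiv.Perm X) (A : X → G) : ℕ → X → G
  | 0, _ => 1
  | n + 1, x => A ((f ^ n) x) * cocycleNat f A n x

/-- The iterates `A_n(x)` for `n : ℤ`, with `A_{-n}(x) = (A_n(f^{-n} x))⁻¹`. -/
def cocycle (f : Equiv.Perm X) (A : X → G) : ℤ → X → G
  | Int.ofNat n, x => cocycleNat f A n x
  | Int.negSucc n, x => (cocycleNat f A (n + 1) ((f ^ (n + 1)).symm x))⁻¹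

end Cocycle

/-- The set `B(A, κ)` of the points `x` such that `‖A_n(x)‖ ≤ κ` and `‖A_n(x)⁻¹‖ ≤ κ` for all
`n : ℤ`; the norm is the operator norm of the Euclidean norm. -/
def boundedSet {X : Type*} {d : ℕ} {G : Subgroup (GL (Fin d) ℝ)} (f : Equiv.Perm X) (A : X → G)
    (κ : ℝ) : Set X :=
  {x | ∀ n : ℤ, ‖(cocycle f A n x : G).1.val‖ ≤ κ ∧ ‖((cocycle f A n x)⁻¹ : G).1.val‖ ≤ κ}

/-- The matrix-valued map underlying a `G`-valued map. -/
def toMat {X : Type*} {d : ℕ} {G : Subgroup (GL (Fin d) ℝ)} (A : X → G) (x : X) :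
    Matrix (Fin d) (Fin d) ℝ :=
  (A x : GL (Fin d) ℝ).val

/-- `‖F(x) - F(y)‖ ≤ C dist(x, y)^α` for some `C > 0` and all `x`, `y`. -/
def IsHolderMat {X : Type*} [MetricSpace X] {d : ℕ} (α : ℝ)
    (F : X → Matrix (Fin d) (Fin d) ℝ) : Prop :=
  ∃ C : ℝ, 0 < C ∧ ∀ x y : X, ‖F x - F y‖ ≤ C * dist x y ^ α

/-- The `C^0` norm, with values in `[0, ∞]`. -/
noncomputable def c0Norm {X : Type*} {d : ℕ} (F : X → Matrix (Fin d) (Fin d) ℝ) : ℝ≥0∞ :=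
  ⨆ x : X, ‖F x‖ₑ

/-- The `α`-Hölder semi-norm
`sup {‖F(x) - F(y)‖ / dist(x, y)^α : 0 < dist(x, y) < diam X}`, with values in `[0, ∞]`. -/
noncomputable def holderSeminorm {X : Type*} [MetricSpace X] {d : ℕ} (α : ℝ)
    (F : X → Matrix (Fin d) (Fin d) ℝ) : ℝ≥0∞ :=
  ⨆ (x : X) (y : X) (_ : 0 < dist x y ∧ dist x y < Metric.diam (Set.univ : Set X)),
    ‖F x - F y‖ₑ / ENNReal.ofReal (dist x y ^ α)

/-- The distance `‖A - B‖_{C^0} + |A - B|_{C^α}`. -/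
noncomputable def holderDist {X : Type*} [MetricSpace X] {d : ℕ} {G : Subgroup (GL (Fin d) ℝ)}
    (α : ℝ) (A B : X → G) : ℝ≥0∞ :=
  c0Norm (fun x => toMat A x - toMat B x) + holderSeminorm α (fun x => toMat A x - toMat B x)

/-! ### The multiple covering condition -/

section Covering

variable {𝒜 : Type*}

/-- The cocycle `A` depends on the positions `-k, …, k` and is represented by `φ` (only the values
of `φ` on admissible words of length `2k + 1` matter). -/
def IsRepresentedBy {H : Matrix 𝒜 𝒜 ℕ} {G : Type*} (A : SFT H → G) (k : ℕ) (φ : List 𝒜 → G) :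
    Prop :=
  ∀ x : SFT H, A x = φ (x.block k)

/-- The product of a cocycle represented by `φ` along a word `w = (w_1, …, w_n)`:
`φ(w_{n-2k-1}, …, w_{n-1}) ⋯ φ(w_2, …, w_{2k+2}) φ(w_1, …, w_{2k+1})`. One factor for each block
of length `2k + 1` in `w` but the last one, so that for a transition `w` between blocks of this
length it is the iterate of the cocycle from the first block to the last one. -/
def wordProd {G : Type*} [Group G] (k : ℕ) (φ : List 𝒜 → G) (w : List 𝒜) : G :=
  ((List.range (w.length - (2 * k + 1))).map
    fun i => φ ((w.drop i).take (2 * k + 1))).reverse.prod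

/-- The data `U`, `S`, `Λ` witness the multiple covering condition of `m` layers for the cocycle
represented by `φ` on the positions `-k, …, k`. -/
structure IsMultipleCovering (H : Matrix 𝒜 𝒜 ℕ) {G : Type*} [Group G] [TopologicalSpace G]
    (k : ℕ) (φ : List 𝒜 → G) {m n : ℕ} (U : Fin n → Set G) (S : Set (List 𝒜))
    (Λ : List 𝒜 → Fin n → Fin m → Set (List 𝒜)) : Prop where
  pos : 0 < n
  isOpen : ∀ i, IsOpen (U i)
  nonempty : ∀ i, (U i).Nonempty
  precompact : ∀ i, IsCompact (closure (U i))
  words_nonempty : S.Nonempty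
  words_subset : S ⊆ admissibleWords H (2 * k + 1)
  transitions_nonempty : ∀ a ∈ S, ∀ i j, (Λ a i j).Nonempty
  transitions_subset : ∀ a ∈ S, ∀ i j, Λ a i j ⊆ ⋃ b ∈ S, transitions H a b
  /-- The layers are mutually disjoint. -/
  disjoint : ∀ a ∈ S, ∀ i j j', j ≠ j' → Disjoint (Λ a i j) (Λ a i j')
  /-- No word of the union of the layers is a strict prefix of another one. -/
  antichain : ∀ a ∈ S, ∀ i, IsAntichain (fun v w => v <+: w) (⋃ j, Λ a i j)
  covers : ∀ a ∈ S, ∀ i j,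
    closure (U i) ⊆ ⋃ w ∈ Λ a i j, {g : G | wordProd k φ w * g ∈ ⋃ i', U i'}

/-- The multiple covering condition of `m` layers for a locally constant cocycle. -/
def MultipleCovering {H : Matrix 𝒜 𝒜 ℕ} {G : Type*} [Group G] [TopologicalSpace G]
    (A : SFT H → G) (m : ℕ) : Prop :=
  ∃ (k : ℕ) (φ : List 𝒜 → G), IsRepresentedBy A k φ ∧
    ∃ (n : ℕ) (U : Fin n → Set G) (S : Set (List 𝒜)) (Λ : List 𝒜 → Fin n → Fin m → Set (List 𝒜)),
      IsMultipleCovering H k φ U S Λ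

/-- The multiple covering condition of `m` layers, realized by words of length at most `L`. -/
def MultipleCoveringOfLength {H : Matrix 𝒜 𝒜 ℕ} {G : Type*} [Group G] [TopologicalSpace G]
    (A : SFT H → G) (m L : ℕ) : Prop :=
  ∃ (k : ℕ) (φ : List 𝒜 → G), IsRepresentedBy A k φ ∧
    ∃ (n : ℕ) (U : Fin n → Set G) (S : Set (List 𝒜)) (Λ : List 𝒜 → Fin n → Fin m → Set (List 𝒜)),
      IsMultipleCovering H k φ U S Λ ∧ ∀ a ∈ S, ∀ i j, ∀ w ∈ Λ a i j, w.length ≤ L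

end Covering

/-! Fix `g₀` in one of the sets `U i` and follow its orbit under the perturbed cocycle `B`. Whenever
this orbit lies in some `U i` while the point shows a word of `S`, each of the `m` layers offers a
word along which `A` brings it back into some `U i'`. By compactness, finitely many words suffice
and the return has a uniform margin `r` (`IsMultipleCovering.exists_margin`). The point is then
spliced so that it shows the chosen word, and the process goes on.

The difficulty is that changing the future of the point also changes the value of `B` at earlier
times. Since `A` is locally constant, only the perturbation feels the change, and its Hölder
seminorm makes the contributions decay geometrically into the past. Their sum is of order `ε`,
provided the iterates of `B` are bounded by a fixed `κ`. They are, because at each return `B_t =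
(B_t g₀) g₀⁻¹` with `B_t g₀` in the bounded union of the `U i`. Closeness and boundedness are
therefore proved together, for all points with the same past: this is `IsControlled`, and its
induction step is `IsControlled.exists_next`.

The free choice of layers produces an `m`-ary tree (`BranchingSystem`). Layers are disjoint and no
word is a prefix of another, so different choices give different points within a window of length
linear in the number of choices. Recentring at late times and passing to limits gives two-sided
points whose whole orbits satisfy the bound `κ * κ` (`BranchingSystem.exists_separated`). These
orbits form a closed invariant set. Having `m ^ M` points separated within time `M * L` yields
entropy at least `log m / L` (`SFT.log_div_le_coverEntropy`). -/

/-- Along a non-principal ultrafilter, every sequence of bi-infinite sequences over a finite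
alphabet converges coordinatewise. -/
theorem exists_coordinatewise_limit {𝒜 : Type*} [Finite 𝒜] (f : ℕ → ℤ → 𝒜) :
    ∃ g : ℤ → 𝒜, ∀ i, ∀ᶠ N in (Filter.hyperfilter ℕ : Filter ℕ), f N i = g i := by
  have h : ∀ i, ∃ a, ∀ᶠ N in (Filter.hyperfilter ℕ : Filter ℕ), f N i = a := by
    intro i
    obtain ⟨a, ha⟩ := Ultrafilter.eq_pure_of_finite ((Filter.hyperfilter ℕ).map fun N => f N i)
    refine ⟨a, ?_⟩
    have h1 : ({a} : Set 𝒜) ∈ (Filter.hyperfilter ℕ).map fun N => f N i := by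
      rw [ha]; exact Set.mem_singleton a
    exact h1
  choose g hg using h
  exact ⟨g, hg⟩

/-! ### Metric, shift and words read in points of the subshift. -/

namespace SFT

variable {𝒜 : Type*} {H : Matrix 𝒜 𝒜 ℕ}

theorem shift_apply (x : SFT H) (i : ℤ) : (shift H x) i = x (i + 1) := rfl

theorem shift_pow_apply (n : ℕ) (x : SFT H) (i : ℤ) : ((shift H ^ n) x) i = x (i + n) := by
  induction n generalizing i with
  | zero => simp
  | succ n ih =>
    rw [pow_succ', Equiv.Perm.mul_apply, shift_apply, ih]
    exact congrArg x.1 (by push_cast; ring)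

theorem shift_iterate_apply (n : ℕ) (x : SFT H) (i : ℤ) : ((shift H)^[n] x) i = x (i + n) := by
  rw [Equiv.Perm.iterate_eq_pow, shift_pow_apply]

theorem shift_zpow_apply (n : ℤ) (x : SFT H) (i : ℤ) : ((shift H ^ n) x) i = x (i + n) := by
  cases n with
  | ofNat n => exact shift_pow_apply n x i
  | negSucc n =>
    obtain ⟨y, rfl⟩ : ∃ y, (shift H ^ (n + 1)) y = x := (shift H ^ (n + 1)).surjective x
    rw [zpow_negSucc, Equiv.Perm.inv_def, Equiv.symm_apply_apply, shift_pow_apply]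
    exact congrArg y.1 (by rw [Int.negSucc_eq]; push_cast; ring)

theorem dist_le_of_agree {x y : SFT H} {n : ℕ} (h : ∀ i : ℤ, i.natAbs < n → x i = y i) :
    dist x y ≤ (2 : ℝ)⁻¹ ^ n := by
  by_cases hxy : x = y
  · rw [hxy, dist_self]; positivity
  · obtain ⟨i, hi, hne⟩ := firstDiff_spec hxy
    rw [dist_of_ne hxy]
    refine pow_le_pow_of_le_one (by norm_num) (by norm_num) ?_
    by_contra hlt
    exact hne (h i (by omega))

theorem agree_of_dist_lt {x y : SFT H} {n : ℕ} (h : dist x y < (2 : ℝ)⁻¹ ^ n) (i : ℤ)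
    (hi : i.natAbs ≤ n) : x i = y i := by
  by_contra hne
  have hxy : x ≠ y := fun h => hne (by rw [h])
  rw [dist_of_ne hxy] at h
  exact absurd h (not_lt.2 (pow_le_pow_of_le_one (by norm_num) (by norm_num)
    ((firstDiff_le hne).trans hi)))

theorem dist_le_one (x y : SFT H) : dist x y ≤ 1 := by
  simpa using dist_le_of_agree (x := x) (y := y) (n := 0) (fun i hi => absurd hi (by omega))

theorem isBounded_univ : Bornology.IsBounded (Set.univ : Set (SFT H)) :=
  Metric.isBounded_iff.2 ⟨1, fun x _ y _ => dist_le_one x y⟩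

/-- Different points with the same central letter are closer than the diameter. -/
theorem dist_lt_diam {x y : SFT H} (hne : x ≠ y) (h0 : x 0 = y 0) :
    dist x y < Metric.diam (Set.univ : Set (SFT H)) := by
  obtain ⟨i, -, hi⟩ := firstDiff_spec hne
  have h1 : dist x y ≤ (2 : ℝ)⁻¹ ^ 1 := dist_le_of_agree fun j hj => by
    have : j = 0 := by omega
    rw [this, h0]
  -- Shifting a difference to the centre shows that the diameter is at least 1, whereas `dist x y ≤
  -- 1/2`.
  have h2 : 1 ≤ dist ((shift H ^ i) x) ((shift H ^ i) y) := by
    by_contra hlt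
    have := agree_of_dist_lt (n := 0) (by simpa using not_le.1 hlt) 0 (by simp)
    rw [shift_zpow_apply, shift_zpow_apply, zero_add] at this
    exact hi this
  have h3 := Metric.dist_le_diam_of_mem (isBounded_univ (H := H))
    (Set.mem_univ ((shift H ^ i) x)) (Set.mem_univ ((shift H ^ i) y))
  norm_num at h1
  linarith

/-- The first difference comes closer to the centre by at most one place, so distances at most
double. -/
theorem continuous_shift : Continuous (shift H) := by
  refine (LipschitzWith.of_dist_le_mul (K := 2) fun x y => ?_).continuous
  by_cases hxy : x = y
  · simp [hxy]
  rw [dist_of_ne hxy]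
  refine (dist_le_of_agree (n := firstDiff x y - 1) fun i hi => ?_).trans ?_
  · by_contra hne
    have := firstDiff_le (x := x) (y := y) hne
    omega
  · rcases Nat.eq_zero_or_pos (firstDiff x y) with h | h
    · rw [h]; norm_num
    · obtain ⟨n, hn⟩ := Nat.exists_eq_add_of_lt h
      rw [hn, zero_add, pow_succ, Nat.add_sub_cancel]
      simp only [NNReal.coe_ofNat]
      exact le_of_eq (by ring)

theorem continuous_shift_symm : Continuous (shift H).symm := by
  refine (LipschitzWith.of_dist_le_mul (K := 2) fun x y => ?_).continuous
  by_cases hxy : x = y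
  · simp [hxy]
  rw [dist_of_ne hxy]
  refine (dist_le_of_agree (n := firstDiff x y - 1) fun i hi => ?_).trans ?_
  · by_contra hne
    have := firstDiff_le (x := x) (y := y) hne
    omega
  · rcases Nat.eq_zero_or_pos (firstDiff x y) with h | h
    · rw [h]; norm_num
    · obtain ⟨n, hn⟩ := Nat.exists_eq_add_of_lt h
      rw [hn, zero_add, pow_succ, Nat.add_sub_cancel]
      simp only [NNReal.coe_ofNat]
      exact le_of_eq (by ring)

theorem continuous_shift_zpow (n : ℤ) : Continuous (shift H ^ n : Equiv.Perm (SFT H)) := by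
  cases n with
  | ofNat n =>
    change Continuous (shift H ^ n : Equiv.Perm (SFT H))
    rw [← Equiv.Perm.iterate_eq_pow]
    exact continuous_shift.iterate n
  | negSucc n =>
    rw [zpow_negSucc, ← inv_pow, ← Equiv.Perm.iterate_eq_pow]
    exact continuous_shift_symm.iterate (n + 1)

/-- Coordinatewise convergence along a filter implies convergence. -/
theorem tendsto_of_eventually_eq {ι : Type*} {l : Filter ι} {f : ι → SFT H} {x : SFT H}
    (h : ∀ i, ∀ᶠ N in l, f N i = x i) : Filter.Tendsto f l (nhds x) := by
  rw [Metric.tendsto_nhds]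
  intro ε hε
  obtain ⟨n, hn⟩ := exists_pow_lt_of_lt_one hε (show (2 : ℝ)⁻¹ < 1 by norm_num)
  have h1 : ∀ᶠ N in l, ∀ i ∈ Set.Icc (-(n : ℤ)) n, f N i = x i :=
    (Filter.eventually_all_finite (Set.finite_Icc _ _)).2 fun i _ => h i
  filter_upwards [h1] with N hN
  refine (dist_le_of_agree (n := n) fun i hi => hN i ?_).trans_lt hn
  rw [Set.mem_Icc]; omega

/-- A sequence in the subshift converges coordinatewise along a non-principal ultrafilter. -/
theorem exists_hyperfilter_limit [Finite 𝒜] (f : ℕ → SFT H) :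
    ∃ x : SFT H, ∀ i, ∀ᶠ N in (Filter.hyperfilter ℕ : Filter ℕ), f N i = x i := by
  obtain ⟨g, hg⟩ := exists_coordinatewise_limit fun N => (f N).1
  refine ⟨⟨g, fun i => ?_⟩, hg⟩
  obtain ⟨N, h1, h2⟩ := ((hg i).and (hg (i + 1))).exists
  rw [← h1, ← h2]
  exact (f N).2 i

/-- The word `w` is read in `x` from the position `s` on. -/
def Reads (x : ℤ → 𝒜) (s : ℤ) (w : List 𝒜) : Prop :=
  ∀ (q : ℕ) (h : q < w.length), x (s + q) = w[q]

theorem Reads.of_prefix {x : ℤ → 𝒜} {s : ℤ} {v w : List 𝒜} (h : Reads x s w) (hv : v <+: w) :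
    Reads x s v := fun q hq => by
  rw [h q (hq.trans_le hv.length_le), hv.getElem hq]

theorem Reads.drop {x : ℤ → 𝒜} {s : ℤ} {w : List 𝒜} (h : Reads x s w) (u : ℕ) :
    Reads x (s + u) (w.drop u) := fun q hq => by
  rw [List.length_drop] at hq
  rw [List.getElem_drop, ← h (u + q) (by omega)]
  congr 1; push_cast; ring

theorem Reads.of_suffix {x : ℤ → 𝒜} {s : ℤ} {v w : List 𝒜} (h : Reads x s w) (hv : v <:+ w) :
    Reads x (s + (w.length - v.length : ℕ)) v := by
  rw [List.suffix_iff_eq_drop.1 hv]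
  have := hv.length_le
  simpa [Nat.sub_sub_self this] using h.drop (w.length - v.length)

theorem Reads.congr {x y : ℤ → 𝒜} {s : ℤ} {w : List 𝒜} (h : Reads x s w)
    (hxy : ∀ i, s ≤ i → i < s + w.length → x i = y i) : Reads y s w := fun q hq => by
  rw [← hxy (s + q) (by omega) (by omega), h q hq]

theorem Reads.prefix_of_le {x : ℤ → 𝒜} {s : ℤ} {v w : List 𝒜} (hv : Reads x s v)
    (hw : Reads x s w) (h : v.length ≤ w.length) : v <+: w := by
  rw [List.prefix_iff_eq_take]
  refine List.ext_getElem (by simp [h]) fun q h1 h2 => ?_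
  rw [List.getElem_take, ← hv q h1, ← hw q (h1.trans_le h)]

theorem Reads.eq_of_length {x : ℤ → 𝒜} {s : ℤ} {v w : List 𝒜} (hv : Reads x s v)
    (hw : Reads x s w) (h : v.length = w.length) : v = w :=
  (hv.prefix_of_le hw h.le).eq_of_length h

theorem length_block (k : ℕ) (x : SFT H) : (block k x).length = 2 * k + 1 := by simp [block]

theorem reads_block (k : ℕ) (x : SFT H) : Reads x (-k) (block k x) := fun q hq => by
  simp only [block, List.getElem_ofFn]
  exact congrArg x.1 (by ring)

theorem reads_block_shift (k n : ℕ) (x : SFT H) :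
    Reads x (n - k) (block k ((shift H ^ n) x)) := fun q hq => by
  rw [← reads_block k _ q hq, shift_pow_apply]
  exact congrArg x.1 (by ring)

theorem block_shift_eq {k n : ℕ} {x : SFT H} {b : List 𝒜} (hb : b.length = 2 * k + 1)
    (h : Reads x (n - k) b) : block k ((shift H ^ n) x) = b :=
  (reads_block_shift k n x).eq_of_length h (by rw [length_block, hb])

theorem block_eq_of_agree {k : ℕ} {x y : SFT H}
    (h : ∀ i : ℤ, i.natAbs ≤ k → x i = y i) : block k x = block k y := by
  refine ((reads_block k x).congr fun i h1 h2 => h i ?_).eq_of_length (reads_block k y)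
    (by rw [length_block, length_block])
  rw [length_block] at h2; omega

end SFT

/-! ### Extending and splicing admissible sequences. -/

section Rays

variable {𝒜 : Type*} {H : Matrix 𝒜 𝒜 ℕ} {l : ℕ} {S : Set (List 𝒜)}

/-- Every word of `S` is a strict prefix of an admissible word with a suffix in `S`. -/
def IsExtendable (H : Matrix 𝒜 𝒜 ℕ) (S : Set (List 𝒜)) : Prop :=
  ∀ b ∈ S, ∃ w, IsAdmissible H w ∧ b <+: w ∧ b.length < w.length ∧ ∃ b' ∈ S, b' <:+ w

/-- An admissible word that ends with a word of `S` extends to an admissible one-sided sequence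
in which words of `S` occur at arbitrarily late positions. -/
theorem exists_ray (hS : S ⊆ admissibleWords H l) (hext : IsExtendable H S)
    {u : List 𝒜} (hu : IsAdmissible H u) (hub : ∃ b ∈ S, b <:+ u) :
    ∃ r : ℕ → 𝒜, (∀ n, H (r n) (r (n + 1)) = 1) ∧ (∀ q (h : q < u.length), r q = u[q]) ∧
      ∀ N, ∃ n ≥ N, (List.ofFn fun q : Fin l => r (n + q)) ∈ S := by
  let P := {u : List 𝒜 // IsAdmissible H u ∧ ∃ b ∈ S, b <:+ u}
  have hstep : ∀ p : P, ∃ p' : P, p.1 <+: p'.1 ∧ p.1.length < p'.1.length := by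
    rintro ⟨v, hv, b, hb, v', rfl⟩
    obtain ⟨w, hw, ⟨w', rfl⟩, hlen, b', hb', hsuf⟩ := hext b hb
    have hne : b ≠ [] := (hS hb).1.1
    refine ⟨⟨v' ++ b ++ w', ⟨by simp [hne], ?_⟩, b', hb', ?_⟩, by simp, by simpa using hlen⟩
    · exact hv.2.append_overlap hw.2 hne
    · exact hsuf.trans ⟨v', by simp⟩
  choose next hpre hlt using hstep
  let s : ℕ → P := fun n => next^[n] ⟨u, hu, hub⟩
  have hs : ∀ n, s (n + 1) = next (s n) := fun n => Function.iterate_succ_apply' _ _ _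
  have hmono : ∀ n n', n ≤ n' → (s n).1 <+: (s n').1 := by
    intro n n' h
    induction n', h using Nat.le_induction with
    | base => exact List.prefix_rfl
    | succ n' _ ih => exact ih.trans (by rw [hs]; exact hpre _)
  have hlen : ∀ n, n ≤ (s n).1.length := by
    intro n
    induction n with
    | zero => exact Nat.zero_le _
    | succ n ih => rw [hs]; exact ih.trans_lt (hlt _)
  -- The words `s n` are nested, so the letter at `q` is the same in every stage that reaches it,
  -- and stage `q + 1` does.
  have hr : ∀ n q (hq : q < (s n).1.length), (s (q + 1)).1[q]'(hlen (q + 1)) = (s n).1[q] := by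
    intro n q hq
    rcases le_total n (q + 1) with h | h
    · exact ((hmono _ _ h).getElem hq).symm
    · exact (hmono _ _ h).getElem (hlen (q + 1))
  refine ⟨fun q => (s (q + 1)).1[q]'(hlen (q + 1)), fun n => ?_, fun q hq => hr 0 q hq,
    fun N => ?_⟩
  · have h2 : n + 1 < (s (n + 2)).1.length := hlen (n + 2)
    have h3 := List.isChain_iff_getElem.1 (s (n + 2)).2.1.2 n h2
    rwa [← hr (n + 2) n (by omega), ← hr (n + 2) (n + 1) h2] at h3
  -- Stage `N + l` has length at least `N + l`, so its suffix of length `l` starts at `N` or later.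
  · obtain ⟨b, hb, hsuf⟩ := (s (N + l)).2.2
    have hbl : b.length = l := (hS hb).2
    have h1 := hlen (N + l)
    refine ⟨(s (N + l)).1.length - l, by omega, ?_⟩
    convert hb using 1
    refine List.ext_getElem (by simp [hbl]) fun q h2 h3 => ?_
    rw [List.getElem_ofFn]
    simp only
    rw [hr (N + l) _ (by omega)]
    conv_rhs => rw [List.getElem_of_eq (List.suffix_iff_eq_drop.1 hsuf), List.getElem_drop]
    simp [hbl]

/-- Some point of the subshift shows a word of `S` at the position `s`. -/
theorem exists_reads_mem [Finite 𝒜] (hS : S ⊆ admissibleWords H l)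
    (hext : IsExtendable H S) (hne : S.Nonempty) (s : ℤ) :
    ∃ p : SFT H, ∃ b ∈ S, SFT.Reads p s b := by
  obtain ⟨b, hb⟩ := hne
  obtain ⟨r, hr, -, hinf⟩ := exists_ray hS hext (hS hb).1 ⟨b, hb, List.suffix_rfl⟩
  choose n hn hmem using hinf
  -- Recentring the one-sided ray at later and later occurrences makes the limit two-sided. The
  -- truncation by `toNat` does not matter, as each position is eventually non-negative.
  obtain ⟨g, hg⟩ := exists_coordinatewise_limit fun N (i : ℤ) => r ((n N : ℤ) + i - s).toNat
  have hlarge : ∀ i : ℤ, ∀ᶠ N in (Filter.hyperfilter ℕ : Filter ℕ), 0 ≤ (n N : ℤ) + i - s := by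
    intro i
    refine (Filter.Eventually.filter_mono Nat.hyperfilter_le_atTop
      (Filter.eventually_ge_atTop (s - i).toNat)).mono fun N hN => ?_
    have := hn N
    omega
  refine ⟨⟨g, fun i => ?_⟩, List.ofFn fun q : Fin l => g (s + q), ?_, fun q hq => by simp⟩
  · obtain ⟨N, h1, h2, h3⟩ := ((hg i).and ((hg (i + 1)).and (hlarge i))).exists
    rw [← h1, ← h2, show (n N : ℤ) + (i + 1) - s = (n N : ℤ) + i - s + 1 by ring,
      Int.toNat_add h3 (by norm_num)]
    exact hr _
  · obtain ⟨N, hN⟩ := (Filter.eventually_all.2 fun q : Fin l => hg (s + q)).exists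
    convert hmem N using 3 with q
    rw [← hN q]
    congr 1; omega

/-- A point in which `b` is read can be changed to the right of this occurrence, so that an
admissible word with the prefix `b` and a suffix in `S` is read instead. -/
theorem exists_splice (hS : S ⊆ admissibleWords H l) (hext : IsExtendable H S)
    (y : SFT H) (s : ℤ) {b w : List 𝒜} (hb : b ∈ S) (hy : SFT.Reads y s b)
    (hw : IsAdmissible H w) (hbw : b <+: w) (hsuf : ∃ b' ∈ S, b' <:+ w) :
    ∃ y' : SFT H, (∀ i < s + l, y' i = y i) ∧ SFT.Reads y' s w := by
  obtain ⟨r, hr, hrw, -⟩ := exists_ray hS hext hw hsuf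
  have hbl : b.length = l := (hS hb).2
  have hl : 0 < b.length := List.length_pos_iff.2 (hS hb).1.1
  have hrb : ∀ q, q < l → r q = y (s + q) := fun q hq => by
    rw [hrw q (by have := hbw.length_le; omega), hy q (by omega), hbw.getElem (by omega)]
  -- The past of `y` is glued to the ray at `s`. Both show `b` from there on, so the non-empty
  -- overlap makes the junction admissible and nothing changes before `s + l`.
  obtain ⟨z, hz⟩ : ∃ z : ℤ → 𝒜, ∀ i, z i = if i < s then y i else r (i - s).toNat :=
    ⟨_, fun _ => rfl⟩
  have hlt : ∀ i < s, z i = y i := fun i hi => by rw [hz, if_pos hi]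
  have hge : ∀ q : ℕ, z (s + q) = r q := fun q => by
    rw [hz, if_neg (by omega)]; congr 1; omega
  have hle : ∀ i < s + l, z i = y i := fun i hi => by
    rcases lt_or_ge i s with h | h
    · exact hlt i h
    · obtain ⟨q, rfl⟩ := Int.le.dest h
      rw [hge, hrb q (by omega)]
  refine ⟨⟨z, fun i => ?_⟩, hle, fun q hq => (hge q).trans (hrw q hq)⟩
  rcases lt_or_ge i s with h | h
  · rw [hle i (by omega), hle (i + 1) (by omega)]
    exact y.2 i
  · obtain ⟨q, rfl⟩ := Int.le.dest h
    have := hge (q + 1)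
    push_cast at this
    rw [hge, add_assoc, this]
    exact hr q

end Rays

/-! ### Cocycle identities. -/

section CocycleAlgebra

variable {X Γ : Type*} [Group Γ] (f : Equiv.Perm X) (A : X → Γ)

theorem cocycleNat_add (u t : ℕ) (x : X) :
    cocycleNat f A (u + t) x = cocycleNat f A u ((f ^ t) x) * cocycleNat f A t x := by
  induction u with
  | zero => simp [cocycleNat]
  | succ u ih =>
    rw [Nat.add_right_comm, cocycleNat, ih, cocycleNat, pow_add, Equiv.Perm.mul_apply, mul_assoc]

/-- For `s = t + n` with `s, t ≥ 0`, the iterate `A_n` at `f ^ t x` is `A_s(x) A_t(x)⁻¹`. -/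
theorem cocycle_pow_apply {n : ℤ} {s t : ℕ} (h : (s : ℤ) = t + n) (x : X) :
    cocycle f A n ((f ^ t) x) = cocycleNat f A s x * (cocycleNat f A t x)⁻¹ := by
  cases n with
  | ofNat n =>
    obtain rfl : s = n + t := by rw [Int.ofNat_eq_natCast] at h; omega
    rw [cocycleNat_add, mul_inv_cancel_right]; rfl
  | negSucc n =>
    obtain rfl : t = (n + 1) + s := by rw [Int.negSucc_eq] at h; omega
    have h1 : (f ^ (n + 1)).symm ((f ^ (n + 1 + s)) x) = (f ^ s) x := by
      rw [pow_add f (n + 1) s, Equiv.Perm.mul_apply, Equiv.symm_apply_apply]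
    rw [cocycle, h1, cocycleNat_add f A (n + 1) s, mul_inv_rev, mul_inv_cancel_left]

/-- The difference of two cocycle iterates as a sum over the factors. -/
theorem cocycleNat_sub_eq_sum {R : Type*} [Ring R] (ι : Γ →* R) (B : X → Γ) (t : ℕ) (x y : X) :
    ι (cocycleNat f A t x) - ι (cocycleNat f B t y) =
      ∑ s ∈ Finset.range t, ι (cocycleNat f A t x * (cocycleNat f A (s + 1) x)⁻¹) *
        (ι (A ((f ^ s) x)) - ι (B ((f ^ s) y))) * ι (cocycleNat f B s y) := by
  -- Telescoping over the hybrid products that use `B` for the first `s` factors and `A` for the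
  -- others.
  have h : ∀ s, ι (cocycleNat f A t x * (cocycleNat f A (s + 1) x)⁻¹) *
        (ι (A ((f ^ s) x)) - ι (B ((f ^ s) y))) * ι (cocycleNat f B s y) =
      ι (cocycleNat f A t x * (cocycleNat f A s x)⁻¹ * cocycleNat f B s y) -
      ι (cocycleNat f A t x * (cocycleNat f A (s + 1) x)⁻¹ * cocycleNat f B (s + 1) y) := by
    intro s
    rw [mul_sub, sub_mul, ← map_mul, ← map_mul, ← map_mul, ← map_mul]
    congr 2 <;> simp only [cocycleNat] <;> group
  rw [Finset.sum_congr rfl fun s _ => h s, Finset.sum_range_sub']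
  simp [cocycleNat]

end CocycleAlgebra

/-! ### Norm bounds in `G`. -/

section Bounds

variable {d : ℕ} {G : Subgroup (GL (Fin d) ℝ)}

/-- The inclusion of `G` into the matrices, as a homomorphism. -/
def matHom (G : Subgroup (GL (Fin d) ℝ)) : G →* Matrix (Fin d) (Fin d) ℝ :=
  (Units.coeHom _).comp G.subtype

/-- Units of a complete normed ring carry the norm topology. Closeness in `G` can thus be tested by
the operator norm alone, without looking at inverses. -/
theorem isInducing_matHom : Topology.IsInducing (matHom G) :=
  (Units.isOpenEmbedding_val.isInducing).comp Topology.IsInducing.subtypeVal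

theorem continuous_matHom : Continuous (matHom G) := isInducing_matHom.continuous

/-- The norms of `g` and of its inverse are at most `κ`. -/
def IsBdd (κ : ℝ) (g : G) : Prop := ‖matHom G g‖ ≤ κ ∧ ‖matHom G g⁻¹‖ ≤ κ

/-- Only an inequality, because for `d = 0` the matrix ring is trivial and the norm vanishes. -/
theorem norm_matHom_one_le : ‖matHom G 1‖ ≤ 1 := by
  rw [map_one]
  rcases subsingleton_or_nontrivial (Matrix (Fin d) (Fin d) ℝ) with h | h
  · rw [Subsingleton.elim (1 : Matrix (Fin d) (Fin d) ℝ) 0, norm_zero]; norm_num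
  · exact CStarRing.norm_one.le

theorem isBdd_one : IsBdd (G := G) 1 1 :=
  ⟨norm_matHom_one_le, by rw [inv_one]; exact norm_matHom_one_le⟩

variable {κ κ' : ℝ} {g h : G}

theorem IsBdd.nonneg (hg : IsBdd κ g) : 0 ≤ κ := (norm_nonneg _).trans hg.1

theorem IsBdd.mono (hg : IsBdd κ g) (hκ : κ ≤ κ') : IsBdd κ' g := ⟨hg.1.trans hκ, hg.2.trans hκ⟩

theorem IsBdd.inv (hg : IsBdd κ g) : IsBdd κ g⁻¹ := ⟨hg.2, by rw [inv_inv]; exact hg.1⟩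

theorem IsBdd.mul (hg : IsBdd κ g) (hh : IsBdd κ' h) : IsBdd (κ * κ') (g * h) := by
  refine ⟨?_, ?_⟩
  · rw [map_mul]
    exact (norm_mul_le _ _).trans (mul_le_mul hg.1 hh.1 (norm_nonneg _) hg.nonneg)
  · rw [mul_inv_rev, map_mul, mul_comm κ κ']
    exact (norm_mul_le _ _).trans (mul_le_mul hh.2 hg.2 (norm_nonneg _) hh.nonneg)

theorem isClosed_setOf_isBdd (κ : ℝ) : IsClosed {g : G | IsBdd κ g} :=
  (isClosed_le continuous_matHom.norm continuous_const).inter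
    (isClosed_le (continuous_matHom.comp continuous_inv).norm continuous_const)

/-- A compact set of matrices in `G` is bounded, together with the inverses. -/
theorem exists_isBdd_of_isCompact {K : Set G} (hK : IsCompact K) :
    ∃ κ : ℝ, ∀ g ∈ K, IsBdd κ g := by
  obtain ⟨a, ha⟩ := hK.exists_bound_of_continuousOn (f := matHom G) continuous_matHom.continuousOn
  obtain ⟨b, hb⟩ := hK.exists_bound_of_continuousOn (f := fun g => matHom G g⁻¹)
    (continuous_matHom.comp continuous_inv).continuousOn
  exact ⟨max a b, fun g hg => ⟨(ha g hg).trans (le_max_left _ _),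
    (hb g hg).trans (le_max_right _ _)⟩⟩

theorem exists_isBdd_of_finite {K : Set G} (hK : K.Finite) : ∃ κ : ℝ, ∀ g ∈ K, IsBdd κ g :=
  exists_isBdd_of_isCompact hK.isCompact

/-- A bound for the perturbations of a bounded element. -/
theorem IsBdd.of_near {c ε : ℝ} (hg : IsBdd c g) (hc : 1 ≤ c) (hε : ε * (2 * c) ≤ 1)
    (hh : ‖matHom G g - matHom G h‖ ≤ ε) : IsBdd (2 * c) h := by
  have hε0 : 0 ≤ ε := (norm_nonneg _).trans hh
  have h1 : ‖matHom G h‖ ≤ ‖matHom G g‖ + ‖matHom G g - matHom G h‖ := norm_le_insert _ _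
  -- The resolvent identity. As `ε * c ≤ 1/2`, its second term is at most half of `‖h⁻¹‖` and can be
  -- absorbed.
  have h2 : matHom G h⁻¹ = matHom G g⁻¹ +
      matHom G h⁻¹ * (matHom G g - matHom G h) * matHom G g⁻¹ := by
    rw [mul_sub, sub_mul, ← map_mul, ← map_mul, ← map_mul, ← map_mul]; simp
  have h3 : ‖matHom G h⁻¹‖ ≤ c + ‖matHom G h⁻¹‖ * ε * c := by
    conv_lhs => rw [h2]
    refine (norm_add_le _ _).trans (add_le_add hg.2 ?_)
    refine (norm_mul_le _ _).trans (mul_le_mul ?_ hg.2 (norm_nonneg _) (by positivity))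
    exact (norm_mul_le _ _).trans (mul_le_mul_of_nonneg_left hh (norm_nonneg _))
  have h4 := norm_nonneg (matHom G h⁻¹)
  refine ⟨?_, ?_⟩
  · nlinarith [hg.1]
  · nlinarith

variable {X : Type*} (f : Equiv.Perm X) (A B : X → G)

theorem isBdd_cocycleNat {c : ℝ} (hA : ∀ x, IsBdd c (A x)) (n : ℕ) (x : X) :
    IsBdd (c ^ n) (cocycleNat f A n x) := by
  induction n with
  | zero => rw [pow_zero]; exact isBdd_one
  | succ n ih => rw [pow_succ']; exact (hA _).mul ih

/-- Two cocycle iterates that are bounded by `κ` along the way differ by at most `κ ^ 3` times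
the sum of the differences of the factors. -/
theorem norm_cocycleNat_sub_le {t : ℕ} {x y : X} {e : ℕ → ℝ}
    (hA : ∀ s ≤ t, IsBdd κ (cocycleNat f A s x)) (hB : ∀ s ≤ t, IsBdd κ (cocycleNat f B s y))
    (he : ∀ s < t, ‖matHom G (A ((f ^ s) x)) - matHom G (B ((f ^ s) y))‖ ≤ e s) :
    ‖matHom G (cocycleNat f A t x) - matHom G (cocycleNat f B t y)‖ ≤
      κ ^ 3 * ∑ s ∈ Finset.range t, e s := by
  rw [cocycleNat_sub_eq_sum, Finset.mul_sum]
  refine norm_sum_le_of_le _ fun s hs => ?_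
  rw [Finset.mem_range] at hs
  have hκ : 0 ≤ κ := (hA t le_rfl).nonneg
  have h1 := (hA t le_rfl).mul (hA (s + 1) hs).inv
  calc _ ≤ κ * κ * e s * κ := by
        refine (norm_mul_le _ _).trans (mul_le_mul ?_ (hB s hs.le).1 (norm_nonneg _) ?_)
        · exact (norm_mul_le _ _).trans (mul_le_mul h1.1 (he s hs) (norm_nonneg _) (by positivity))
        · have := (norm_nonneg _).trans (he s hs)
          positivity
    _ = κ ^ 3 * e s := by ring

end Bounds

/-! ### Hölder perturbations of a locally constant cocycle. -/

section Holder

variable {𝒜 : Type*} {H : Matrix 𝒜 𝒜 ℕ} {d : ℕ} {G : Subgroup (GL (Fin d) ℝ)} {α ε : ℝ}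
  {A B : SFT H → G}

theorem norm_sub_le_of_holderDist_lt (hε : 0 ≤ ε) (h : holderDist α A B < ENNReal.ofReal ε)
    (x : SFT H) : ‖matHom G (A x) - matHom G (B x)‖ ≤ ε := by
  have h1 : ‖toMat A x - toMat B x‖ₑ ≤ ENNReal.ofReal ε :=
    (le_iSup (fun x => ‖toMat A x - toMat B x‖ₑ) x).trans (le_self_add.trans h.le)
  rw [← ofReal_norm, ENNReal.ofReal_le_ofReal_iff hε] at h1
  exact h1

/-- The seminorm only sees pairs closer than the diameter; a common central letter guarantees this
by `SFT.dist_lt_diam`. -/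
theorem norm_sub_sub_le_of_holderDist_lt (hε : 0 ≤ ε) (h : holderDist α A B < ENNReal.ofReal ε)
    {x y : SFT H} (h0 : x 0 = y 0) :
    ‖(matHom G (A x) - matHom G (B x)) - (matHom G (A y) - matHom G (B y))‖ ≤
      ε * dist x y ^ α := by
  by_cases hxy : x = y
  · rw [hxy, sub_self, norm_zero]; positivity
  have hd : 0 < dist x y := dist_pos.2 hxy
  have hd' : 0 < dist x y ^ α := Real.rpow_pos_of_pos hd α
  have h1 : ‖(toMat A x - toMat B x) - (toMat A y - toMat B y)‖ₑ / ENNReal.ofReal (dist x y ^ α)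
      ≤ ENNReal.ofReal ε := by
    refine le_trans ?_ (le_add_self.trans h.le)
    exact le_iSup_of_le x (le_iSup_of_le y (le_iSup_of_le ⟨hd, SFT.dist_lt_diam hxy h0⟩ le_rfl))
  rw [ENNReal.div_le_iff (by simpa using hd') (by simp), ← ENNReal.ofReal_mul hε, ← ofReal_norm,
    ENNReal.ofReal_le_ofReal_iff (by positivity)] at h1
  exact h1

theorem continuous_of_isHolderMat (hα : 0 < α) (h : IsHolderMat α (toMat A)) : Continuous A := by
  rw [isInducing_matHom.continuous_iff, continuous_iff_continuousAt]
  obtain ⟨C, -, hC⟩ := h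
  intro x
  refine tendsto_iff_norm_sub_tendsto_zero.2 (squeeze_zero (fun _ => norm_nonneg _)
    (fun y => hC y x) ?_)
  have h1 : Filter.Tendsto (fun y => dist y x) (nhds x) (nhds 0) :=
    tendsto_iff_dist_tendsto_zero.1 Filter.tendsto_id
  have h2 := (h1.rpow_const (p := α) (Or.inr hα.le)).const_mul C
  rwa [Real.zero_rpow hα.ne', mul_zero] at h2

theorem continuous_cocycleNat {f : Equiv.Perm (SFT H)}
    (hf : ∀ n : ℕ, Continuous (f ^ n : Equiv.Perm (SFT H)))
    (hA : Continuous A) (n : ℕ) : Continuous (cocycleNat f A n) := by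
  induction n with
  | zero => exact continuous_const
  | succ n ih => exact (hA.comp (hf n)).mul ih

theorem continuous_cocycle_shift (hA : Continuous A) (n : ℤ) :
    Continuous (cocycle (SFT.shift H) A n) := by
  have hf : ∀ n : ℕ, Continuous (SFT.shift H ^ n : Equiv.Perm (SFT H)) := fun n =>
    SFT.continuous_shift_zpow n
  cases n with
  | ofNat n => exact continuous_cocycleNat hf hA n
  | negSucc n =>
    exact ((continuous_cocycleNat hf hA (n + 1)).comp
      (SFT.continuous_shift_zpow (-(n + 1 : ℕ) : ℤ))).inv

/-- Points that agree up to the time `t + k` have close iterates of the perturbed cocycle, as long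
as these iterates are bounded. -/
theorem norm_cocycleNat_sub_le_of_agree {k t : ℕ} {κ : ℝ} {φ : List 𝒜 → G} (hα : 0 < α)
    (hε : 0 ≤ ε) (hφ : IsRepresentedBy A k φ) (h : holderDist α A B < ENNReal.ofReal ε)
    {x y : SFT H} (hxy : ∀ i ≤ (t + k : ℤ), x i = y i)
    (hx : ∀ s ≤ t, IsBdd κ (cocycleNat (SFT.shift H) B s x))
    (hy : ∀ s ≤ t, IsBdd κ (cocycleNat (SFT.shift H) B s y)) :
    ‖matHom G (cocycleNat (SFT.shift H) B t x) - matHom G (cocycleNat (SFT.shift H) B t y)‖ ≤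
      κ ^ 3 * (ε * (1 - (2 : ℝ)⁻¹ ^ α)⁻¹) := by
  have hρ0 : 0 ≤ (2 : ℝ)⁻¹ ^ α := by positivity
  have hρ1 : (2 : ℝ)⁻¹ ^ α < 1 := Real.rpow_lt_one (by norm_num) (by norm_num) hα
  have hκ : 0 ≤ κ := (hx 0 (Nat.zero_le _)).nonneg
  refine (norm_cocycleNat_sub_le (SFT.shift H) B B
    (e := fun s => ε * ((2 : ℝ)⁻¹ ^ α) ^ (t - 1 - s)) hx hy fun s hs => ?_).trans ?_
  · have hagree : ∀ i : ℤ, i.natAbs ≤ t - s + k →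
        (SFT.shift H ^ s) x i = (SFT.shift H ^ s) y i := fun i hi => by
      rw [SFT.shift_pow_apply, SFT.shift_pow_apply]
      exact hxy _ (by omega)
    -- The agreement reaches beyond `k`, so `A` does not distinguish the two points. Only the
    -- perturbation contributes, which gives the factor `ε` and geometric decay in `t - s`.
    have h1 : A ((SFT.shift H ^ s) x) = A ((SFT.shift H ^ s) y) := by
      rw [hφ, hφ, SFT.block_eq_of_agree fun i hi => hagree i (by omega)]
    have h2 := norm_sub_sub_le_of_holderDist_lt hε h (hagree 0 (by simp))
    rw [h1, sub_sub_sub_cancel_left, norm_sub_rev] at h2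
    refine h2.trans (mul_le_mul_of_nonneg_left ?_ hε)
    rw [Real.rpow_pow_comm (by norm_num)]
    exact Real.rpow_le_rpow dist_nonneg
      (SFT.dist_le_of_agree fun i hi => hagree i (by omega)) hα.le
  · refine mul_le_mul_of_nonneg_left ?_ (by positivity)
    rw [← Finset.mul_sum, Finset.sum_range_reflect (fun j => ((2 : ℝ)⁻¹ ^ α) ^ j) t]
    refine mul_le_mul_of_nonneg_left ?_ hε
    rw [← tsum_geometric_of_lt_one hρ0 hρ1]
    exact (summable_geometric_of_lt_one hρ0 hρ1).sum_le_tsum _ fun j _ => pow_nonneg hρ0 j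

/-- The product along a word that is read in a point is a cocycle iterate. -/
theorem wordProd_eq_cocycleNat {k t : ℕ} {φ : List 𝒜 → G} (hφ : IsRepresentedBy A k φ)
    {x : SFT H} {w : List 𝒜} (hw : SFT.Reads x (t - k) w) :
    wordProd k φ w =
      cocycleNat (SFT.shift H) A (w.length - (2 * k + 1)) ((SFT.shift H ^ t) x) := by
  have h : ∀ u ≤ w.length - (2 * k + 1), ((List.range u).map
      fun i => φ ((w.drop i).take (2 * k + 1))).reverse.prod =
      cocycleNat (SFT.shift H) A u ((SFT.shift H ^ t) x) := by
    intro u hu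
    induction u with
    | zero => simp [cocycleNat]
    | succ u ih =>
      rw [List.range_succ, List.map_append, List.reverse_append, List.prod_append, ih (by omega),
        cocycleNat, ← Equiv.Perm.mul_apply, ← pow_add, hφ,
        SFT.block_shift_eq (b := (w.drop u).take (2 * k + 1))]
      · simp
      · rw [List.length_take, List.length_drop]; omega
      · have := (hw.drop u).of_prefix (List.take_prefix (2 * k + 1) _)
        convert this using 1
        push_cast; ring
  exact h _ le_rfl

end Holder

/-! ### Compactness: finite covers with a uniform margin. -/

section Margin

variable {𝒜 : Type*} {d : ℕ} {G : Subgroup (GL (Fin d) ℝ)}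

/-- A cover of a compact set by translates of open sets has a finite subcover with a margin. -/
theorem exists_finite_cover_with_margin {ι : Type*} {U : ι → Set G} (hU : ∀ i, IsOpen (U i))
    {K : Set G} (hK : IsCompact K) {Λ : Set (List 𝒜)} (P : List 𝒜 → G)
    (hcov : K ⊆ ⋃ w ∈ Λ, {g : G | P w * g ∈ ⋃ i, U i}) :
    ∃ F ⊆ Λ, F.Finite ∧ ∃ r > 0, ∀ p ∈ K, ∃ w ∈ F, ∃ i, ∀ q : G,
      ‖matHom G q - matHom G (P w * p)‖ < r → q ∈ U i := by
  refine hK.induction_on (p := fun K => ∃ F ⊆ Λ, F.Finite ∧ ∃ r > 0, ∀ p ∈ K, ∃ w ∈ F, ∃ i,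
    ∀ q : G, ‖matHom G q - matHom G (P w * p)‖ < r → q ∈ U i) ?_ ?_ ?_ ?_
  · exact ⟨∅, Set.empty_subset _, Set.finite_empty, 1, one_pos, by simp⟩
  · rintro s t hst ⟨F, hF, hfin, r, hr, h⟩
    exact ⟨F, hF, hfin, r, hr, fun p hp => h p (hst hp)⟩
  · rintro s t ⟨F, hF, hfin, r, hr, h⟩ ⟨F', hF', hfin', r', hr', h'⟩
    refine ⟨F ∪ F', Set.union_subset hF hF', hfin.union hfin', min r r', lt_min hr hr', ?_⟩
    rintro p (hp | hp)
    · obtain ⟨w, hw, i, hi⟩ := h p hp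
      exact ⟨w, Or.inl hw, i, fun q hq => hi q (hq.trans_le (min_le_left _ _))⟩
    · obtain ⟨w, hw, i, hi⟩ := h' p hp
      exact ⟨w, Or.inr hw, i, fun q hq => hi q (hq.trans_le (min_le_right _ _))⟩
  · intro p hp
    obtain ⟨w, hw, hpw⟩ := Set.mem_iUnion₂.1 (hcov hp)
    obtain ⟨i, hi⟩ := Set.mem_iUnion.1 hpw
    obtain ⟨r, hr, hball⟩ := ((isInducing_matHom (G := G)).nhds_eq_comap (P w * p) ▸
      (Metric.nhds_basis_ball.comap (matHom G))).mem_iff.1 ((hU i).mem_nhds hi)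
    have hc : Continuous fun g : G => matHom G (P w * g) :=
      continuous_matHom.comp (continuous_const_mul (P w))
    -- Half of the radius lets the point vary near `p`; the other half remains as margin.
    refine ⟨_, mem_nhdsWithin_of_mem_nhds (hc.continuousAt.preimage_mem_nhds
      (Metric.ball_mem_nhds _ (half_pos hr))), {w}, by simpa using hw, Set.finite_singleton _,
      r / 2, half_pos hr, fun g hg => ⟨w, rfl, i, fun q hq => hball ?_⟩⟩
    have hg' : ‖matHom G (P w * g) - matHom G (P w * p)‖ < r / 2 := by
      simpa [dist_eq_norm] using hg
    have := norm_sub_le_norm_sub_add_norm_sub (matHom G q) (matHom G (P w * g))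
      (matHom G (P w * p))
    rw [Set.mem_preimage, Metric.mem_ball, dist_eq_norm]
    linarith

/-- A positive lower bound for finitely many positive numbers. -/
theorem exists_pos_le_of_finite {ι : Type*} [Finite ι] {r : ι → ℝ} (hr : ∀ i, 0 < r i) :
    ∃ r₀ > 0, ∀ i, r₀ ≤ r i := by
  have h1 : ∀ᶠ x in nhdsWithin (0 : ℝ) (Set.Ioi 0), ∀ i, x ≤ r i :=
    Filter.eventually_all.2 fun i => Filter.Eventually.filter_mono nhdsWithin_le_nhds
      (Filter.Eventually.mono (eventually_lt_nhds (hr i)) fun _ h => h.le)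
  obtain ⟨x, hx, hx0⟩ := (h1.and self_mem_nhdsWithin).exists
  exact ⟨x, hx0, hx⟩

variable {H : Matrix 𝒜 𝒜 ℕ} {k m n : ℕ} {φ : List 𝒜 → G} {U : Fin n → Set G}
  {S : Set (List 𝒜)} {Λ : List 𝒜 → Fin n → Fin m → Set (List 𝒜)}

theorem finite_of_subset_admissibleWords [Finite 𝒜] {l : ℕ} (hS : S ⊆ admissibleWords H l) :
    S.Finite :=
  (List.finite_length_eq 𝒜 l).subset fun _ h => (hS h).2

/-- The data of a multiple covering can be replaced by data with words of bounded length that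
cover with a uniform margin. -/
theorem IsMultipleCovering.exists_margin [Finite 𝒜] (h : IsMultipleCovering H k φ U S Λ) :
    ∃ (Λ' : List 𝒜 → Fin n → Fin m → Set (List 𝒜)) (L : ℕ) (r : ℝ),
      IsMultipleCovering H k φ U S Λ' ∧ (∀ a ∈ S, ∀ i j, ∀ w ∈ Λ' a i j, w.length ≤ L) ∧ 0 < L ∧
      0 < r ∧ ∀ a ∈ S, ∀ i j, ∀ p ∈ closure (U i), ∃ w ∈ Λ' a i j, ∃ i', ∀ q : G,
        ‖matHom G q - matHom G (wordProd k φ w * p)‖ < r → q ∈ U i' := by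
  have hfin : S.Finite := finite_of_subset_admissibleWords h.words_subset
  have : Finite S := hfin
  have key : ∀ (a : List 𝒜) (i : Fin n) (j : Fin m), ∃ F ⊆ Λ a i j, F.Finite ∧ ∃ r > 0,
      a ∈ S → ∀ p ∈ closure (U i), ∃ w ∈ F, ∃ i', ∀ q : G,
        ‖matHom G q - matHom G (wordProd k φ w * p)‖ < r → q ∈ U i' := by
    intro a i j
    by_cases ha : a ∈ S
    · obtain ⟨F, hF, hfin, r, hr, hcov⟩ := exists_finite_cover_with_margin h.isOpen
        (h.precompact i) (wordProd k φ) (h.covers a ha i j)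
      exact ⟨F, hF, hfin, r, hr, fun _ => hcov⟩
    · exact ⟨∅, Set.empty_subset _, Set.finite_empty, 1, one_pos, fun h => absurd h ha⟩
  choose F hFΛ hFfin r hr hcov using key
  obtain ⟨r₀, hr₀, hle⟩ := exists_pos_le_of_finite (ι := S × Fin n × Fin m)
    (r := fun x => r x.1 x.2.1 x.2.2) fun x => hr _ _ _
  have hW : (⋃ x : S × Fin n × Fin m, F x.1 x.2.1 x.2.2).Finite :=
    Set.finite_iUnion fun x => hFfin _ _ _
  obtain ⟨L, hL⟩ := (hW.image List.length).bddAbove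
  have hcov' : ∀ a ∈ S, ∀ i j, ∀ p ∈ closure (U i), ∃ w ∈ F a i j, ∃ i', ∀ q : G,
      ‖matHom G q - matHom G (wordProd k φ w * p)‖ < r₀ → q ∈ U i' := by
    intro a ha i j p hp
    obtain ⟨w, hw, i', hi'⟩ := hcov a i j ha p hp
    exact ⟨w, hw, i', fun q hq => hi' q (hq.trans_le (hle (⟨a, ha⟩, i, j)))⟩
  -- Disjointness and the prefix condition pass to smaller layers; the margin gives covering and
  -- non-emptiness. `L + 1` keeps the length bound positive.
  refine ⟨F, L + 1, r₀, ⟨h.pos, h.isOpen, h.nonempty, h.precompact, h.words_nonempty,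
    h.words_subset, ?_, ?_, ?_, ?_, ?_⟩, ?_, L.succ_pos, hr₀, hcov'⟩
  · intro a ha i j
    obtain ⟨p, hp⟩ := (h.nonempty i).closure
    obtain ⟨w, hw, -⟩ := hcov' a ha i j p hp
    exact ⟨w, hw⟩
  · exact fun a ha i j => (hFΛ a i j).trans (h.transitions_subset a ha i j)
  · exact fun a ha i j j' hj => (h.disjoint a ha i j j' hj).mono (hFΛ a i j) (hFΛ a i j')
  · exact fun a ha i => (h.antichain a ha i).subset (Set.iUnion_mono fun j => hFΛ a i j)
  · intro a ha i j p hp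
    obtain ⟨w, hw, i', hi'⟩ := hcov' a ha i j p hp
    exact Set.mem_biUnion hw (Set.mem_iUnion.2 ⟨i', hi' _ (by simpa using hr₀)⟩)
  · intro a ha i j w hw
    exact (hL (Set.mem_image_of_mem _ (Set.mem_iUnion.2 ⟨(⟨a, ha⟩, i, j), hw⟩))).trans L.le_succ

/-- With several layers, all transitions are longer than the words of `S`. -/
theorem IsMultipleCovering.lt_length (h : IsMultipleCovering H k φ U S Λ) (hm : 1 < m)
    {a : List 𝒜} (ha : a ∈ S) {i : Fin n} {j : Fin m} {w : List 𝒜} (hw : w ∈ Λ a i j) :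
    2 * k + 1 < w.length := by
  obtain ⟨b, -, hb⟩ := Set.mem_iUnion₂.1 (h.transitions_subset a ha i j hw)
  have hal : a.length = 2 * k + 1 := (h.words_subset ha).2
  refine lt_of_le_of_ne (hal ▸ hb.2.1.length_le) fun hlen => ?_
  -- A word this short is `a` itself, hence a prefix of every word of another layer, against the
  -- antichain condition.
  have haw : a = w := hb.2.1.eq_of_length (hal.trans hlen)
  have : Nontrivial (Fin m) := Fin.nontrivial_iff_two_le.2 hm
  obtain ⟨j', hj'⟩ := exists_ne j
  obtain ⟨v, hv⟩ := h.transitions_nonempty a ha i j'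
  obtain ⟨c, -, hc⟩ := Set.mem_iUnion₂.1 (h.transitions_subset a ha i j' hv)
  have hne : w ≠ v := fun e =>
    (Set.disjoint_left.1 (h.disjoint a ha i j j' hj'.symm)) hw (e ▸ hv)
  exact h.antichain a ha i (Set.mem_iUnion.2 ⟨j, hw⟩) (Set.mem_iUnion.2 ⟨j', hv⟩) hne
    (haw ▸ hc.2.1)

theorem IsMultipleCovering.isExtendable (h : IsMultipleCovering H k φ U S Λ) (hm : 1 < m) :
    IsExtendable H S := by
  intro b hb
  obtain ⟨w, hw⟩ := h.transitions_nonempty b hb ⟨0, h.pos⟩ ⟨0, by omega⟩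
  obtain ⟨c, hc, hwc⟩ := Set.mem_iUnion₂.1 (h.transitions_subset b hb _ _ hw)
  exact ⟨w, hwc.1, hwc.2.1, (h.words_subset hb).2 ▸ h.lt_length hm hb hw, c, hc, hwc.2.2⟩

end Margin

/-! ### The induction step: returning with the perturbed cocycle. -/

section Step

variable {𝒜 : Type*} {H : Matrix 𝒜 𝒜 ℕ} {d : ℕ} {G : Subgroup (GL (Fin d) ℝ)}
  {k m n L : ℕ} {φ : List 𝒜 → G} {U : Fin n → Set G}
  {S : Set (List 𝒜)} {Λ : List 𝒜 → Fin n → Fin m → Set (List 𝒜)}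
  {A B : SFT H → G} {α ε r c ρ κ : ℝ} {g₀ : G}

/-- At the time `t` the point `y` shows a word of `S`, and for all points with the same past up to
the position `t + k` the orbit of `g₀` under the cocycle is in `U i` at the time `t` and the
cocycle is bounded up to this time. -/
structure IsControlled (B : SFT H → G) (k : ℕ) (U : Fin n → Set G) (S : Set (List 𝒜)) (g₀ : G)
    (κ : ℝ) (y : SFT H) (t : ℕ) (i : Fin n) : Prop where
  block_mem : SFT.block k ((SFT.shift H ^ t) y) ∈ S
  mem : ∀ z : SFT H, (∀ l ≤ (t + k : ℤ), z l = y l) →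
    cocycleNat (SFT.shift H) B t z * g₀ ∈ U i
  isBdd : ∀ z : SFT H, (∀ l ≤ (t + k : ℤ), z l = y l) →
    ∀ s ≤ t, IsBdd κ (cocycleNat (SFT.shift H) B s z)

/-- From a controlled point one passes, in every layer, to a controlled point at a later time
that has the same past and continues with a word of this layer. -/
theorem IsControlled.exists_next (h : IsMultipleCovering H k φ U S Λ) (hm : 1 < m)
    (hL : ∀ a ∈ S, ∀ i j, ∀ w ∈ Λ a i j, w.length ≤ L)
    (hr : ∀ a ∈ S, ∀ i j, ∀ p ∈ closure (U i), ∃ w ∈ Λ a i j, ∃ i', ∀ q : G,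
        ‖matHom G q - matHom G (wordProd k φ w * p)‖ < r → q ∈ U i')
    (hφ : IsRepresentedBy A k φ) (hα : 0 < α) (hε : 0 ≤ ε)
    (hAB : holderDist α A B < ENNReal.ofReal ε) (hc : 1 ≤ c)
    (hA : ∀ x, IsBdd c (A x)) (hB : ∀ x, IsBdd c (B x)) (hU : ∀ i, ∀ g ∈ U i, IsBdd ρ g)
    (hg₀ : IsBdd ρ g₀) (hκ : c ^ L * (ρ * ρ) = κ)
    (hsmall : (c ^ L) ^ 3 * (L * ε) * ρ + c ^ L * (κ ^ 3 * (ε * (1 - (2 : ℝ)⁻¹ ^ α)⁻¹)) * ρ < r)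
    {y : SFT H} {t : ℕ} {i : Fin n} (hy : IsControlled B k U S g₀ κ y t i) (j : Fin m) :
    ∃ (y' : SFT H) (t' : ℕ) (i' : Fin n), ∃ w ∈ Λ (SFT.block k ((SFT.shift H ^ t) y)) i j,
      IsControlled B k U S g₀ κ y' t' i' ∧ SFT.Reads y' (t - k) w ∧
      (∀ l ≤ (t + k : ℤ), y' l = y l) ∧ t' + (2 * k + 1) = t + w.length := by
  -- The word is chosen for the single point `B_t(y) g₀`; the margin must serve all other points
  -- with the same past.
  obtain ⟨w, hw, i', hi'⟩ := hr _ hy.block_mem i j _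
    (subset_closure (hy.mem y fun _ _ => rfl))
  have hlen := h.lt_length hm hy.block_mem hw
  obtain ⟨b, hb, hwb⟩ := Set.mem_iUnion₂.1 (h.transitions_subset _ hy.block_mem i j hw)
  obtain ⟨y', hy', hread⟩ := exists_splice h.words_subset (h.isExtendable hm) y (t - k)
    hy.block_mem (SFT.reads_block_shift k t y) hwb.1 hwb.2.1 ⟨b, hb, hwb.2.2⟩
  obtain ⟨u, hu⟩ : ∃ u, u = w.length - (2 * k + 1) := ⟨_, rfl⟩
  have huL : u ≤ L := by have := hL _ hy.block_mem i j w hw; omega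
  have hagree : ∀ l ≤ (t + k : ℤ), y' l = y l := fun l hl => hy' l (by push_cast; omega)
  have hblen : b.length = 2 * k + 1 := (h.words_subset hb).2
  have hρ : 0 ≤ ρ := hg₀.nonneg
  have hpow : ∀ v ≤ L, c ^ v ≤ c ^ L := fun v hv => pow_le_pow_right₀ hc hv
  have hC : ∀ (D : SFT H → G), (∀ x, IsBdd c (D x)) → ∀ v ≤ u, ∀ x,
      IsBdd (c ^ L) (cocycleNat (SFT.shift H) D v x) := fun D hD v hv x =>
    (isBdd_cocycleNat _ D hD v x).mono (hpow v (hv.trans huL))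
  refine ⟨y', u + t, i', w, hw, ⟨?_, fun z hz => ?_, fun z hz s hs => ?_⟩, hread, hagree,
    by omega⟩
  · have h1 := hread.of_suffix hwb.2.2
    rw [SFT.block_shift_eq hblen (b := b)]
    · exact hb
    · convert h1 using 1
      rw [hblen, ← hu]; push_cast; ring
  · have hzy : ∀ l ≤ (t + k : ℤ), z l = y l := fun l hl =>
      (hz l (by push_cast; omega)).trans (hagree l hl)
    have hzw : SFT.Reads z (t - k) w := hread.congr fun l _ hl =>
      (hz l (by push_cast; omega)).symm
    have hword := wordProd_eq_cocycleNat hφ hzw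
    rw [← hu] at hword
    -- The margin absorbs two errors: replacing `B` by `A` along `w`, at most `L` factors, and
    -- replacing `B_t(z)` by `B_t(y)`, the geometric sum.
    refine hi' _ (lt_of_le_of_lt ?_ hsmall)
    have h1 := norm_cocycleNat_sub_le (SFT.shift H) B A (e := fun _ => ε)
      (x := (SFT.shift H ^ t) z) (y := (SFT.shift H ^ t) z) (t := u)
      (fun s hs => hC B hB s hs _) (fun s hs => hC A hA s hs _) (fun s _ => by
        rw [norm_sub_rev]; exact norm_sub_le_of_holderDist_lt hε hAB _)
    rw [Finset.sum_const, Finset.card_range, nsmul_eq_mul] at h1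
    have h2 := norm_cocycleNat_sub_le_of_agree hα hε hφ hAB hzy (hy.isBdd z hzy)
      (hy.isBdd y fun _ _ => rfl)
    have h3 := (hU i _ (hy.mem z hzy)).1
    have h4 := (hC A hA u le_rfl ((SFT.shift H ^ t) z)).1
    rw [← hword] at h1 h4
    rw [cocycleNat_add]
    have h5 : matHom G (cocycleNat (SFT.shift H) B u ((SFT.shift H ^ t) z) *
        cocycleNat (SFT.shift H) B t z * g₀) -
        matHom G (wordProd k φ w * (cocycleNat (SFT.shift H) B t y * g₀)) =
        (matHom G (cocycleNat (SFT.shift H) B u ((SFT.shift H ^ t) z)) -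
          matHom G (wordProd k φ w)) * matHom G (cocycleNat (SFT.shift H) B t z * g₀) +
        matHom G (wordProd k φ w) * (matHom G (cocycleNat (SFT.shift H) B t z) -
          matHom G (cocycleNat (SFT.shift H) B t y)) * matHom G g₀ := by
      simp only [map_mul]; noncomm_ring
    rw [h5]
    have hcL : 0 ≤ c ^ L := by positivity
    refine (norm_add_le _ _).trans (add_le_add ?_ ?_)
    · refine (norm_mul_le _ _).trans (mul_le_mul (h1.trans ?_) h3 (norm_nonneg _) (by positivity))
      gcongr
    · refine (norm_mul_le _ _).trans (mul_le_mul ?_ hg₀.1 (norm_nonneg _)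
        (mul_nonneg hcL ((norm_nonneg _).trans h2)))
      exact (norm_mul_le _ _).trans (mul_le_mul h4 h2 (norm_nonneg _) hcL)
  · have hzy : ∀ l ≤ (t + k : ℤ), z l = y l := fun l hl =>
      (hz l (by push_cast; omega)).trans (hagree l hl)
    rcases le_total s t with hst | hst
    · exact hy.isBdd z hzy s hst
    -- Writing `B_t = (B_t g₀) g₀⁻¹` resets the bound to `ρ * ρ` at time `t`. At most `L` factors
    -- follow, so `κ` does not grow with time.
    · obtain ⟨v, rfl⟩ := Nat.exists_eq_add_of_le' hst
      rw [cocycleNat_add, ← hκ]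
      refine (hC B hB v (by omega) _).mul ?_
      simpa using (hU i _ (hy.mem z hzy)).mul hg₀.inv

end Step

/-! ### The tree of choices. -/

section Tree

variable {𝒜 : Type*} {H : Matrix 𝒜 𝒜 ℕ} {k m L : ℕ} {Q : Type*}

/-- A system of points with distinguished times in which every point has `m` continuations, which
have the same past and continue with words none of which is a prefix of another one. -/
structure BranchingSystem (H : Matrix 𝒜 𝒜 ℕ) (k m L : ℕ) (Q : Type*) where
  pt : Q → SFT H
  time : Q → ℕ
  next : Q → Fin m → Q
  word : Q → Fin m → List 𝒜
  reads : ∀ q j, SFT.Reads (pt (next q j)) (time q - k) (word q j)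
  agree : ∀ q j, ∀ i ≤ (time q + k : ℤ), pt (next q j) i = pt q i
  time_next : ∀ q j, time (next q j) + (2 * k + 1) = time q + (word q j).length
  lt_length : ∀ q j, 2 * k + 1 < (word q j).length
  length_le : ∀ q j, (word q j).length ≤ L
  not_prefix : ∀ q j j', j ≠ j' → ¬ word q j <+: word q j'

namespace BranchingSystem

variable (T : BranchingSystem H k m L Q)

/-- The result of a finite sequence of choices. -/
def run (q : Q) (js : List (Fin m)) : Q := js.foldl T.next q

theorem time_next_gt (q : Q) (j : Fin m) : T.time q < T.time (T.next q j) := by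
  have := T.time_next q j
  have := T.lt_length q j
  omega

theorem time_next_le (q : Q) (j : Fin m) :
    T.time (T.next q j) ≤ T.time q + (L - (2 * k + 1)) := by
  have := T.time_next q j
  have := T.lt_length q j
  have := T.length_le q j
  omega

theorem le_time_run (q : Q) (js : List (Fin m)) : T.time q + js.length ≤ T.time (T.run q js) := by
  induction js generalizing q with
  | nil => exact le_rfl
  | cons j js ih =>
    have := ih (T.next q j)
    have := T.time_next_gt q j
    simp only [List.length_cons]
    change _ ≤ T.time (T.run (T.next q j) js)
    omega

theorem agree_run (q : Q) (js : List (Fin m)) {i : ℤ} (hi : i ≤ T.time q + k) :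
    T.pt (T.run q js) i = T.pt q i := by
  induction js generalizing q with
  | nil => rfl
  | cons j js ih =>
    have := T.time_next_gt q j
    exact (ih (T.next q j) (by omega)).trans (T.agree q j i hi)

/-- Different sequences of choices lead to points that differ at a controlled position. -/
theorem exists_ne_of_ne (q : Q) {js js' : List (Fin m)} (hlen : js.length = js'.length)
    (hne : js ≠ js') (e e' : List (Fin m)) :
    ∃ i : ℤ, (T.time q - k : ℤ) ≤ i ∧ i ≤ T.time q + js.length * (L - (2 * k + 1) : ℕ) + k ∧
      T.pt (T.run q (js ++ e)) i ≠ T.pt (T.run q (js' ++ e')) i := by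
  induction js generalizing js' q with
  | nil => exact absurd (List.eq_nil_of_length_eq_zero hlen.symm).symm hne
  | cons j js ih =>
    obtain ⟨j', js', rfl⟩ := List.exists_cons_of_length_eq_add_one hlen.symm
    by_cases hj : j = j'
    · subst hj
      obtain ⟨i, h1, h2, h3⟩ := ih (T.next q j) (js' := js') (by simpa using hlen)
        (fun h => hne (by rw [h]))
      have h4 := T.time_next_gt q j
      have h5 := T.time_next_le q j
      refine ⟨i, by omega, ?_, h3⟩
      rw [List.length_cons]
      push_cast
      rw [add_mul, one_mul]
      omega
    -- At the first differing choice, agreement on the window would make both words readable at one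
    -- place of one point, so one would be a prefix of the other.
    · by_contra! hcon
      have hread : ∀ j js, SFT.Reads (T.pt (T.run q (j :: js))) (T.time q - k) (T.word q j) :=
        fun j js => (T.reads q j).congr fun i _ hi => by
          have := T.time_next q j
          exact (T.agree_run (T.next q j) js (by omega)).symm
      have hcross : ∀ j₀, SFT.Reads (T.pt (T.run q (j :: js ++ e))) (T.time q - k) (T.word q j₀) →
          SFT.Reads (T.pt (T.run q (j' :: js' ++ e'))) (T.time q - k) (T.word q j₀) :=
        fun j₀ h => h.congr fun i hi hi' => by
          refine hcon i hi ?_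
          have h1 := T.length_le q j₀
          have h2 : 0 ≤ (js.length : ℤ) * (L - (2 * k + 1) : ℕ) := by positivity
          rw [List.length_cons]
          push_cast at h2 ⊢
          rw [add_mul, one_mul]
          have := T.lt_length q j₀
          omega
      have h1 := hcross j (hread j _)
      have h2 := hread j' (js' ++ e')
      rcases le_total (T.word q j).length (T.word q j').length with h | h
      · exact T.not_prefix q j j' hj (h1.prefix_of_le h2 h)
      · exact T.not_prefix q j' j (Ne.symm hj) (h2.prefix_of_le h1 h)

end BranchingSystem

end Tree

/-! ### Two-sided limits with bounded orbits. -/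

section InvariantSet

variable {𝒜 : Type*} {H : Matrix 𝒜 𝒜 ℕ} {d : ℕ} {G : Subgroup (GL (Fin d) ℝ)}
  {k m L : ℕ} {Q : Type*} {B : SFT H → G} {κ : ℝ}

/-- The points whose whole orbit is in the set `B(B, κ)`. -/
def boundedOrbits (B : SFT H → G) (κ : ℝ) : Set (SFT H) :=
  {x | ∀ a : ℤ, (SFT.shift H ^ a) x ∈ boundedSet (SFT.shift H) B κ}

theorem boundedOrbits_subset : boundedOrbits B κ ⊆ boundedSet (SFT.shift H) B κ := fun x hx => by
  simpa using hx 0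

theorem isClosed_boundedOrbits (hB : Continuous B) : IsClosed (boundedOrbits B κ) := by
  have h : boundedOrbits B κ = ⋂ (a : ℤ) (n : ℤ), {x | IsBdd κ
      (cocycle (SFT.shift H) B n ((SFT.shift H ^ a) x))} := by
    ext x; simp only [Set.mem_iInter]; rfl
  rw [h]
  exact isClosed_iInter fun a => isClosed_iInter fun n => (isClosed_setOf_isBdd κ).preimage
    ((continuous_cocycle_shift hB n).comp (SFT.continuous_shift_zpow a))

theorem shift_image_boundedOrbits :
    SFT.shift H '' boundedOrbits B κ = boundedOrbits B κ := by
  ext x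
  rw [Equiv.image_eq_preimage_symm, Set.mem_preimage]
  have h : ∀ (a : ℤ), (SFT.shift H ^ a) ((SFT.shift H).symm x) = (SFT.shift H ^ (a - 1)) x :=
    fun a => by rw [zpow_sub_one]; rfl
  refine ⟨fun hx a => ?_, fun hx a => ?_⟩
  · have := hx (a + 1)
    rwa [h, add_sub_cancel_right] at this
  · rw [h]; exact hx _

/-- The limit points of a branching system along which the cocycle is bounded have bounded orbits,
and they are separated. -/
theorem BranchingSystem.exists_separated [Finite 𝒜] (T : BranchingSystem H k m L Q)
    (hB : Continuous B) (hm : 0 < m) (q₀ : Q)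
    (hbdd : ∀ q, ∀ s ≤ T.time q, IsBdd κ (cocycleNat (SFT.shift H) B s (T.pt q))) (M : ℕ) :
    ∃ x : (Fin M → Fin m) → SFT H, (∀ J, x J ∈ boundedOrbits B (κ * κ)) ∧
      ∀ J J', J ≠ J' → ∃ i : ℤ, (-k : ℤ) ≤ i ∧ i ≤ M * (L - (2 * k + 1) : ℕ) + k ∧
        x J i ≠ x J' i := by
  -- The choices `J` are placed between `N` default choices on either side, which provide an ever
  -- longer controlled past and future around the time of `q N`.
  let z : ℕ → List (Fin m) := fun N => List.replicate N ⟨0, hm⟩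
  let q : ℕ → Q := fun N => T.run q₀ (z N)
  let p : ℕ → (Fin M → Fin m) → Q := fun N J => T.run (q N) (List.ofFn J ++ z N)
  have hq : ∀ N, N ≤ T.time (q N) := fun N => by
    have : T.time q₀ + (z N).length ≤ T.time (q N) := T.le_time_run q₀ (z N)
    rw [List.length_replicate] at this
    omega
  have hp : ∀ N J, T.time (q N) + N ≤ T.time (p N J) := fun N J => by
    have : T.time (q N) + (List.ofFn J ++ z N).length ≤ T.time (p N J) :=
      T.le_time_run (q N) (List.ofFn J ++ z N)
    rw [List.length_append, List.length_replicate] at this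
    omega
  choose x hx using fun J => SFT.exists_hyperfilter_limit fun N =>
    (SFT.shift H ^ T.time (q N)) (T.pt (p N J))
  refine ⟨x, fun J => ?_, fun J J' hJ => ?_⟩
  · intro a n
    have hclosed : IsClosed {x | IsBdd (κ * κ)
        (cocycle (SFT.shift H) B n ((SFT.shift H ^ a) x))} := (isClosed_setOf_isBdd _).preimage
      ((continuous_cocycle_shift hB n).comp (SFT.continuous_shift_zpow a))
    refine hclosed.mem_of_tendsto (SFT.tendsto_of_eventually_eq (hx J)) ?_
    refine Filter.Eventually.filter_mono Nat.hyperfilter_le_atTop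
      ((Filter.eventually_ge_atTop (a.natAbs + n.natAbs)).mono fun N hN => ?_)
    have h1 := hq N
    have h2 := hp N J
    -- For large `N` the times `t` and `s = t + n` lie in the controlled range. The iterate is `B_s
    -- B_t⁻¹`, which explains the bound `κ * κ`.
    obtain ⟨t, ht⟩ := Int.eq_ofNat_of_zero_le (show 0 ≤ a + T.time (q N) by omega)
    obtain ⟨s, hs⟩ := Int.eq_ofNat_of_zero_le (show 0 ≤ (t : ℤ) + n by omega)
    have h3 : (SFT.shift H ^ a) ((SFT.shift H ^ T.time (q N)) (T.pt (p N J))) =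
        (SFT.shift H ^ t) (T.pt (p N J)) := by
      rw [← Equiv.Perm.mul_apply, ← zpow_natCast _ (T.time (q N)), ← zpow_add, ht, zpow_natCast]
    rw [Set.mem_ofPred_eq, h3, cocycle_pow_apply _ _ hs.symm]
    exact (hbdd _ s (by omega)).mul (hbdd _ t (by omega)).inv
  -- The separating window does not depend on `N`, so coincidence of the limits on it would already
  -- occur for some finite `N`.
  · by_contra! hcon
    have h1 : ∀ J, ∀ᶠ N in (Filter.hyperfilter ℕ : Filter ℕ),
        ∀ i ∈ Set.Icc (-k : ℤ) (M * (L - (2 * k + 1) : ℕ) + k),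
          (SFT.shift H ^ T.time (q N)) (T.pt (p N J)) i = x J i := fun J =>
      (Filter.eventually_all_finite (Set.finite_Icc _ _)).2 fun i _ => hx J i
    obtain ⟨N, hN, hN'⟩ := ((h1 J).and (h1 J')).exists
    obtain ⟨i, hi, hi', hne⟩ := T.exists_ne_of_ne (q N) (js := List.ofFn J) (js' := List.ofFn J')
      (by simp) (fun h => hJ (List.ofFn_injective h)) (z N) (z N)
    rw [List.length_ofFn] at hi'
    have h2 : i - T.time (q N) ∈ Set.Icc (-k : ℤ) (M * (L - (2 * k + 1) : ℕ) + k) :=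
      ⟨by omega, by omega⟩
    have h3 := hN _ h2
    have h4 := hN' _ h2
    rw [SFT.shift_pow_apply, sub_add_cancel] at h3 h4
    exact hne (h3.trans ((hcon _ h2.1 h2.2).trans h4.symm))

end InvariantSet

/-! ### Entropy estimate and conclusion. -/

/-- The entropy of a set that has `m ^ M` points which are pairwise separated in the window
`[-k, M L + k)`, for every `M`, is at least `(log m) / L`. -/
theorem SFT.log_div_le_coverEntropy {𝒜 : Type*} {H : Matrix 𝒜 𝒜 ℕ} {Y : Set (SFT H)} {k m L : ℕ}
    (hm : 0 < m) (hL : 0 < L)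
    (h : ∀ M, 0 < M → ∃ x : (Fin M → Fin m) → SFT H, (∀ J, x J ∈ Y) ∧
      ∀ J J', J ≠ J' → ∃ i : ℤ, (-k : ℤ) ≤ i ∧ i < M * L + k ∧ x J i ≠ x J' i) :
    ((Real.log m / L : ℝ) : EReal) ≤ Dynamics.coverEntropy (SFT.shift H) Y := by
  classical
  let V : SetRel (SFT H) (SFT H) := {p | dist p.1 p.2 < (2 : ℝ)⁻¹ ^ k}
  have hV : V ∈ uniformity (SFT H) := Metric.dist_mem_uniformity (by positivity)
  refine le_trans ?_ (Dynamics.netEntropyEntourage_le_coverEntropy _ _ hV)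
  -- The growth rate is a limsup, so times that are multiples of `L` suffice.
  refine Frequently.le_expGrowthSup (Filter.frequently_atTop.2 fun N => ?_)
  refine ⟨(N + 1) * L, by nlinarith, ?_⟩
  obtain ⟨x, hxY, hx⟩ := h (N + 1) N.succ_pos
  have hinj : Function.Injective x := fun J J' hJ => by
    by_contra hne
    obtain ⟨i, -, -, hi⟩ := hx J J' hne
    exact hi (by rw [hJ])
  have hnet : Dynamics.IsDynNetIn (SFT.shift H) Y V ((N + 1) * L)
      (Finset.univ.image x : Finset (SFT H)) := by
    refine ⟨by simpa [Set.range_subset_iff] using hxY, ?_⟩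
    simp only [Finset.coe_image, Finset.coe_univ, Set.image_univ]
    rintro _ ⟨J, rfl⟩ _ ⟨J', rfl⟩ hne
    obtain ⟨i, h1, h2, h3⟩ := hx J J' fun e => hne (by rw [e])
    refine Set.disjoint_left.2 fun z hz hz' => h3 ?_
    rw [Dynamics.mem_ball_dynEntourage] at hz hz'
    -- `s` is `i` clamped to the time interval. The remainder is at most `k`, within the coordinates
    -- seen by the entourage `V`.
    obtain ⟨s, hs, l, hl, rfl⟩ : ∃ s < (N + 1) * L, ∃ l : ℤ, l.natAbs ≤ k ∧ i = l + s := by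
      push_cast at h2
      have hpos : 0 < (N + 1) * L := by positivity
      have h2' : i < ((N + 1) * L : ℕ) + k := by push_cast; exact h2
      generalize (N + 1) * L = R at *
      rcases le_total i 0 with hi | hi
      · exact ⟨0, hpos, i, by omega, by simp⟩
      · by_cases hiR : i < R
        · exact ⟨i.toNat, by omega, 0, by omega, by omega⟩
        · exact ⟨R - 1, by omega, i - (R - 1 : ℕ), by omega, by omega⟩
    have e1 := SFT.agree_of_dist_lt (hz s hs) l hl
    have e2 := SFT.agree_of_dist_lt (hz' s hs) l hl
    rw [SFT.shift_iterate_apply, SFT.shift_iterate_apply] at e1 e2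
    exact e1.trans e2.symm
  have hcard := hnet.card_le_netMaxcard
  rw [Finset.card_image_of_injective _ hinj, Finset.card_univ, Fintype.card_fun, Fintype.card_fin,
    Fintype.card_fin] at hcard
  have hexp : EReal.exp (((Real.log m / L : ℝ) : EReal) * (((N + 1) * L : ℕ) : EReal)) =
      ((m ^ (N + 1) : ℕ) : ℝ≥0∞) := by
    rw [← EReal.coe_natCast, ← EReal.coe_mul, EReal.exp_coe]
    have hL' : (L : ℝ) ≠ 0 := by positivity
    rw [show Real.log m / L * (((N + 1) * L : ℕ) : ℝ) = ((N + 1 : ℕ) : ℝ) * Real.log m by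
      push_cast; field_simp, Real.exp_nat_mul, Real.exp_log (by positivity), ← Nat.cast_pow,
      ENNReal.ofReal_natCast]
  rw [hexp]
  exact_mod_cast hcard

/-- There are finitely many blocks of length `2 * k + 1`, so `A` takes finitely many values. -/
theorem exists_isBdd_of_isRepresentedBy {𝒜 : Type*} [Finite 𝒜] {H : Matrix 𝒜 𝒜 ℕ} {d k : ℕ}
    {G : Subgroup (GL (Fin d) ℝ)} {A : SFT H → G} {φ : List 𝒜 → G} (hφ : IsRepresentedBy A k φ) :
    ∃ c : ℝ, 1 ≤ c ∧ ∀ x, IsBdd c (A x) := by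
  obtain ⟨c, hc⟩ := exists_isBdd_of_finite ((List.finite_length_eq 𝒜 (2 * k + 1)).image φ)
  refine ⟨max 1 c, le_max_left _ _, fun x => (hc _ ?_).mono (le_max_right _ _)⟩
  rw [hφ x]
  exact Set.mem_image_of_mem φ (SFT.length_block k x)

theorem IsMultipleCovering.exists_isBdd {𝒜 : Type*} {H : Matrix 𝒜 𝒜 ℕ} {d k m n : ℕ}
    {G : Subgroup (GL (Fin d) ℝ)} {φ : List 𝒜 → G} {U : Fin n → Set G} {S : Set (List 𝒜)}
    {Λ : List 𝒜 → Fin n → Fin m → Set (List 𝒜)} (h : IsMultipleCovering H k φ U S Λ) :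
    ∃ ρ : ℝ, 1 ≤ ρ ∧ ∀ i, ∀ g ∈ U i, IsBdd ρ g := by
  obtain ⟨ρ, hρ⟩ := exists_isBdd_of_isCompact (isCompact_iUnion fun i => h.precompact i)
  exact ⟨max 1 ρ, le_max_left _ _, fun i g hg =>
    (hρ g (Set.mem_iUnion.2 ⟨i, subset_closure hg⟩)).mono (le_max_right _ _)⟩

theorem theoremC {𝒜 : Type*} [Fintype 𝒜] (H : Matrix 𝒜 𝒜 ℕ)
    (hH : ∀ a b, H a b = 0 ∨ H a b = 1)
    (htrans : IsTransitiveSFT H)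
    (hent : 0 < Dynamics.coverEntropy (SFT.shift H) (Set.univ : Set (SFT H)))
    (d : ℕ) (G : Subgroup (GL (Fin d) ℝ)) (hG : IsClosed (G : Set (GL (Fin d) ℝ)))
    (α : ℝ) (hα : 0 < α)
    (A : SFT H → G) (hA : IsLocallyConstant A)
    (m : ℕ) (hm : 1 < m) (hmc : MultipleCovering A m) :
    ∃ (ε κ γ : ℝ) (L : ℕ), 0 < ε ∧ 0 < κ ∧ 0 < γ ∧
      0 < L ∧ MultipleCoveringOfLength A m L ∧ γ = Real.log m / L ∧
      ∀ A' : SFT H → G, IsHolderMat α (toMat A') →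
        holderDist α A A' < ENNReal.ofReal ε →
        (boundedSet (SFT.shift H) A' κ).Nonempty ∧
        (γ : EReal) ≤ Dynamics.coverEntropy (SFT.shift H) (boundedSet (SFT.shift H) A' κ) ∧
        ∃ Y ⊆ boundedSet (SFT.shift H) A' κ, IsClosed Y ∧ SFT.shift H '' Y = Y ∧
          (γ : EReal) ≤ Dynamics.coverEntropy (SFT.shift H) Y := by
  obtain ⟨k, φ, hφ, n, U, S, Λ₀, hcov₀⟩ := hmc
  obtain ⟨Λ, L, r, hcov, hlen, hL, hr, hmargin⟩ := hcov₀.exists_margin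
  obtain ⟨c₀, hc₀, hAc₀⟩ := exists_isBdd_of_isRepresentedBy hφ
  obtain ⟨ρ, hρ, hUρ⟩ := hcov.exists_isBdd
  obtain ⟨g₀, hg₀⟩ := hcov.nonempty ⟨0, hcov.pos⟩
  -- A common bound for `A` and all its small perturbations, by `IsBdd.of_near`.
  obtain ⟨c, hc⟩ : ∃ c, c = 2 * c₀ := ⟨_, rfl⟩
  obtain ⟨κ, hκ⟩ : ∃ κ, c ^ L * (ρ * ρ) = κ := ⟨_, rfl⟩
  have hc1 : 1 ≤ c := by linarith
  have hκ1 : 1 ≤ κ := hκ ▸ one_le_mul_of_one_le_of_one_le (one_le_pow₀ hc1)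
    (one_le_mul_of_one_le_of_one_le hρ hρ)
  -- Both quantities are continuous in `ε` and vanish at 0; nothing here depends on the
  -- perturbation.
  obtain ⟨ε, ⟨hε1, hε2⟩, hε0⟩ : ∃ ε : ℝ, (ε * (2 * c₀) < 1 ∧ (c ^ L) ^ 3 * (L * ε) * ρ +
      c ^ L * (κ ^ 3 * (ε * (1 - (2 : ℝ)⁻¹ ^ α)⁻¹)) * ρ < r) ∧ ε ∈ Set.Ioi (0 : ℝ) := by
    have h1 : Continuous fun ε : ℝ => ε * (2 * c₀) := by fun_prop
    have h2 : Continuous fun ε : ℝ => (c ^ L) ^ 3 * (L * ε) * ρ +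
      c ^ L * (κ ^ 3 * (ε * (1 - (2 : ℝ)⁻¹ ^ α)⁻¹)) * ρ := by fun_prop
    have h3 := (h1.tendsto' 0 0 (by simp)).eventually_lt_const one_pos
    have h4 := (h2.tendsto' 0 0 (by simp)).eventually_lt_const hr
    exact ((Filter.Eventually.filter_mono nhdsWithin_le_nhds (h3.and h4)).and
      (self_mem_nhdsWithin : Set.Ioi (0 : ℝ) ∈ nhdsWithin 0 (Set.Ioi 0))).exists
  have hγ : 0 < Real.log m / L :=
    div_pos (Real.log_pos (by exact_mod_cast hm)) (by exact_mod_cast hL)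
  refine ⟨ε, κ * κ, Real.log m / L, L, hε0, by positivity, hγ, hL,
    ⟨k, φ, hφ, n, U, S, Λ, hcov, hlen⟩, rfl, fun B hB hAB => ?_⟩
  have hBc : ∀ x, IsBdd c (B x) := fun x => hc ▸ (hAc₀ x).of_near hc₀ hε1.le
    (norm_sub_le_of_holderDist_lt hε0.le hAB x)
  have hAc : ∀ x, IsBdd c (A x) := fun x => (hAc₀ x).mono (by linarith)
  have hBcont : Continuous B := continuous_of_isHolderMat hα hB
  let Q := {s : SFT H × ℕ × Fin n // IsControlled B k U S g₀ κ s.1 s.2.1 s.2.2}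
  have hnext : ∀ (q : Q) (j : Fin m), ∃ q' : Q, ∃ w ∈
      Λ (SFT.block k ((SFT.shift H ^ q.1.2.1) q.1.1)) q.1.2.2 j,
      SFT.Reads q'.1.1 (q.1.2.1 - k) w ∧ (∀ l ≤ (q.1.2.1 + k : ℤ), q'.1.1 l = q.1.1 l) ∧
      q'.1.2.1 + (2 * k + 1) = q.1.2.1 + w.length := by
    rintro ⟨⟨y, t, i⟩, hq⟩ j
    obtain ⟨y', t', i', w, hw, hq', h1, h2, h3⟩ := hq.exists_next hcov hm hlen hmargin hφ hα
      hε0.le hAB hc1 hAc hBc hUρ (hUρ _ g₀ hg₀) hκ hε2 j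
    exact ⟨⟨⟨y', t', i'⟩, hq'⟩, w, hw, h1, h2, h3⟩
  choose next word hword hreads hagree htime using hnext
  let T : BranchingSystem H k m L Q :=
    { pt := fun q => q.1.1
      time := fun q => q.1.2.1
      next := next
      word := word
      reads := hreads
      agree := hagree
      time_next := htime
      lt_length := fun q j => hcov.lt_length hm q.2.block_mem (hword q j)
      length_le := fun q j => hlen _ q.2.block_mem _ _ _ (hword q j)
      not_prefix := fun q j j' hj => hcov.antichain _ q.2.block_mem q.1.2.2
        (Set.mem_iUnion.2 ⟨j, hword q j⟩) (Set.mem_iUnion.2 ⟨j', hword q j'⟩) fun e =>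
          Set.disjoint_left.1 (hcov.disjoint _ q.2.block_mem q.1.2.2 j j' hj) (hword q j)
            (e ▸ hword q j') }
  obtain ⟨p, b, hb, hpb⟩ := exists_reads_mem hcov.words_subset (hcov.isExtendable hm)
    hcov.words_nonempty (-k)
  -- At time 0 the cocycle is the identity, so control only requires `g₀` in the first set and a
  -- word of `S` at the centre.
  let q₀ : Q := ⟨⟨p, 0, ⟨0, hcov.pos⟩⟩, by
    refine ⟨?_, fun z _ => by simpa [cocycleNat] using hg₀, fun z _ s hs => ?_⟩
    · rw [SFT.block_shift_eq (b := b) (hcov.words_subset hb).2 (by simpa using hpb)]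
      exact hb
    · rw [Nat.le_zero.1 hs]
      exact isBdd_one.mono hκ1⟩
  have hsep := T.exists_separated (κ := κ) hBcont (by omega) q₀
    fun q s hs => q.2.isBdd _ (fun _ _ => rfl) s hs
  have hentropy : ((Real.log m / L : ℝ) : EReal) ≤
      Dynamics.coverEntropy (SFT.shift H) (boundedOrbits B (κ * κ)) := by
    refine SFT.log_div_le_coverEntropy (k := k) (by omega) hL fun M hM => ?_
    obtain ⟨x, hx, hne⟩ := hsep M
    refine ⟨x, hx, fun J J' hJ => ?_⟩
    obtain ⟨i, h1, h2, h3⟩ := hne J J' hJ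
    -- A word advances time by at most `L - (2 * k + 1)`; the slack turns the closed window into the
    -- half-open one.
    have : M * (L - (2 * k + 1)) < M * L := Nat.mul_lt_mul_of_pos_left (by omega) hM
    exact ⟨i, h1, by zify at this; omega, h3⟩
  refine ⟨?_, hentropy.trans (Dynamics.coverEntropy_monotone _ boundedOrbits_subset),
    boundedOrbits B (κ * κ), boundedOrbits_subset, isClosed_boundedOrbits hBcont,
    shift_image_boundedOrbits, hentropy⟩
  obtain ⟨x, hx, -⟩ := hsep 0
  exact ⟨x Fin.elim0, boundedOrbits_subset (hx _)⟩
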